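/- A ribbon $\alpha=(\alpha_1,\dots,\alpha_m)$ is the connected skew shape without a $2\times 2$ block whose row lengths, from top to bottom, are $\alpha_1,\dots,\alpha_m$; all $\alpha_i\ge 2$. Its Schur support $[\alpha]$ is the set of partitions $\nu$ for which $s_\nu$ has positive coefficient in the expansion of the skew Schur function $s_\alpha$ as a linear combination of Schur functions. For $\pi\in S_m$ let $\alpha_\pi=(\alpha_{\pi^{-1}(1)},\dots,\alpha_{\pi^{-1}(m)})$; we say that $\alpha$ has full equivalence class if $[\alpha]=[\alpha_\pi]$ for all $\pi\in S_m$. Theorem. Let $m\ge 3$ and let $\alpha=(\alpha_1,\dots,\alpha_m)$ be a ribbon with $\alpha_1\ge\alpha_2\ge\cdots\ge\alpha_m\ge 2$. For $1\le j\le m-2$ let $$N_j=\max\Big\{k\in\mathbb{N} : \sum_{i\le j,\ \alpha_i<k}(k-\alpha_i)\le m-j-2\Big\}.$$ If $1\le j\le m-2$ and $[\alpha]=[\alpha_{(j\ j+1)}]$, where $(j\ j+1)\in S_m$ is the transposition, then $$N_j<\sum_{i=j+1}^m\alpha_i-(m-j-2).$$ In particular, if $\alpha$ has full equivalence class, then this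 inequality holds for all $1\le j\le m-2$. -/

import Mathlib

/-- A semistandard tableau of skew shape `lam / mu`: a filling of the boxes of `lam` that are not in
`mu`, weakly increasing along rows and strictly increasing down columns. As in Mathlib's
`SemistandardYoungTableau`, box `(i, j)` is in row `i` from the top and column `j` from the left,
entries are natural numbers (so the alphabet `1, 2, 3, …` is shifted to `0, 1, 2, …`), and the
entry is `0` outside the shape. -/
@[ext]
structure SkewTableau (lam mu : YoungDiagram) where
  entry : ℕ → ℕ → ℕ
  row_weak : ∀ {i j₁ j₂ : ℕ}, j₁ < j₂ → (i, j₁) ∈ lam.cells \ mu.cells →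
    (i, j₂) ∈ lam.cells \ mu.cells → entry i j₁ ≤ entry i j₂
  col_strict : ∀ {i₁ i₂ j : ℕ}, i₁ < i₂ → (i₁, j) ∈ lam.cells \ mu.cells →
    (i₂, j) ∈ lam.cells \ mu.cells → entry i₁ j < entry i₂ j
  zeros : ∀ {i j : ℕ}, (i, j) ∉ lam.cells \ mu.cells → entry i j = 0

/-- The content of a tableau: `T.content v` is the number of boxes of the shape with entry `v`. -/
noncomputable def SkewTableau.content {lam mu : YoungDiagram} (T : SkewTableau lam mu) : ℕ →₀ ℕ :=
  ∑ b ∈ lam.cells \ mu.cells, Finsupp.single (T.entry b.1 b.2) 1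

/-- For the empty inner shape, these are the semistandard Young tableaux of Mathlib. -/
def SkewTableau.equivStraight (lam : YoungDiagram) :
    SkewTableau lam ⊥ ≃ SemistandardYoungTableau lam where
  toFun T :=
    { entry := T.entry
      row_weak' := fun {_ _ _} h hc => T.row_weak h
        (by simpa using lam.up_left_mem le_rfl h.le hc) (by simpa using hc)
      col_strict' := fun {_ _ _} h hc => T.col_strict h
        (by simpa using lam.up_left_mem h.le le_rfl hc) (by simpa using hc)
      zeros' := fun {_ _} h => T.zeros (by simpa using h) }
  invFun T :=
    { entry := T.entry
      row_weak := fun {_ _ _} h _ hc => T.row_weak h (by simpa using hc)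
      col_strict := fun {_ _ _} h _ hc => T.col_strict h (by simpa using hc)
      zeros := fun {_ _} h => T.zeros (by simpa using h) }
  left_inv _ := rfl
  right_inv _ := rfl

/-- For a given content there are only finitely many tableaux of a given shape. -/
theorem SkewTableau.finite_content (lam mu : YoungDiagram) (d : ℕ →₀ ℕ) :
    Finite {T : SkewTableau lam mu // T.content = d} := by
  have key : ∀ T : {T : SkewTableau lam mu // T.content = d},
      ∀ b : {b // b ∈ lam.cells \ mu.cells}, T.1.entry b.1.1 b.1.2 ∈ d.support := by
    rintro ⟨T, hT⟩ ⟨b, hb⟩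
    change T.entry b.1 b.2 ∈ d.support
    rw [← hT, Finsupp.mem_support_iff]
    intro h
    unfold SkewTableau.content at h
    rw [Finsupp.finsetSum_apply] at h
    have := Finset.sum_eq_zero_iff.1 h b hb
    simp at this
  refine Finite.of_injective
    (fun T (b : {b // b ∈ lam.cells \ mu.cells}) => (⟨_, key T b⟩ : {v // v ∈ d.support})) ?_
  intro T T' h
  apply Subtype.ext
  ext i j
  by_cases hb : (i, j) ∈ lam.cells \ mu.cells
  · exact congrArg Subtype.val (congrFun h ⟨(i, j), hb⟩)
  · rw [T.1.zeros hb, T'.1.zeros hb]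

/-- The skew Schur function `s_{lam/mu} = ∑_T x^T`, a formal power series in countably many
variables: the coefficient of `x^d` is the number of semistandard tableaux of shape `lam / mu` and
content `d`. -/
noncomputable def skewSchur (lam mu : YoungDiagram) : MvPowerSeries ℕ ℤ :=
  fun d => (Nat.card {T : SkewTableau lam mu // T.content = d} : ℤ)

/-- The Schur function `s_nu`. -/
noncomputable def schur (nu : YoungDiagram) : MvPowerSeries ℕ ℤ := skewSchur nu ⊥

/-- `c` is the family of coefficients of `s_{lam/mu}` in the basis of Schur functions:
`s_{lam/mu} = ∑_nu c_nu s_nu`. -/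
def IsSchurExpansion (lam mu : YoungDiagram) (c : YoungDiagram →₀ ℤ) : Prop :=
  skewSchur lam mu = c.sum fun nu a => a • schur nu

/-- The Schur support `[lam/mu]`: the set of `nu` such that `s_nu` appears with positive coefficient
in the expansion of `s_{lam/mu}` as a linear combination of Schur functions. -/
def schurSupport (lam mu : YoungDiagram) : Set YoungDiagram :=
  {nu | ∃ c : YoungDiagram →₀ ℤ, IsSchurExpansion lam mu c ∧ 0 < c nu}

/-- A ribbon with `m` rows, given by its row lengths from top to bottom, each at least `2`. -/
@[ext]
structure Ribbon (m : ℕ) where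
  rowLen : Fin m → ℕ
  two_le : ∀ i, 2 ≤ rowLen i

namespace Ribbon

variable {m : ℕ}

/-- The number of columns strictly to the left of row `i`: consecutive rows overlap in exactly one
column, and the bottom row starts in column `0`. -/
def shift (α : Ribbon m) (i : Fin m) : ℕ := ∑ k ∈ Finset.Ioi i, (α.rowLen k - 1)

theorem shift_eq (α : Ribbon m) (i i' : Fin m) (h : i.val + 1 = i'.val) :
    α.shift i + 1 = α.shift i' + α.rowLen i' := by
  have h1 : Finset.Ioi i = insert i' (Finset.Ioi i') := by
    ext k
    simp only [Finset.mem_Ioi, Finset.mem_insert, Fin.lt_def, Fin.ext_iff]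
    omega
  have h2 := α.two_le i'
  rw [shift, h1, Finset.sum_insert (by simp), ← shift]
  omega

theorem shift_antitone (α : Ribbon m) : Antitone α.shift := by
  intro i i' h
  exact Finset.sum_le_sum_of_subset (Finset.Ioi_subset_Ioi h)

theorem shift_add_rowLen_antitone (α : Ribbon m) :
    Antitone fun i => α.shift i + α.rowLen i := by
  intro i i' h
  rcases h.eq_or_lt with rfl | h
  · exact le_rfl
  have h1 : insert i' (Finset.Ioi i') ⊆ Finset.Ioi i := by
    intro k hk
    simp only [Finset.mem_insert, Finset.mem_Ioi] at hk ⊢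
    rcases hk with rfl | hk
    · exact h
    · exact h.trans hk
  have h2 := Finset.sum_le_sum_of_subset (f := fun k => α.rowLen k - 1) h1
  rw [Finset.sum_insert (by simp)] at h2
  have h3 := α.two_le i
  have h4 := α.two_le i'
  change α.shift i' + α.rowLen i' ≤ α.shift i + α.rowLen i
  unfold shift
  omega

/-- The outer partition of the ribbon, viewed as a skew shape. -/
def outer (α : Ribbon m) : YoungDiagram :=
  YoungDiagram.ofRowLens (List.ofFn fun i => α.shift i + α.rowLen i)
    α.shift_add_rowLen_antitone.sortedGE_ofFn

/-- The inner partition of the ribbon, viewed as a skew shape. -/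
def inner (α : Ribbon m) : YoungDiagram :=
  YoungDiagram.ofRowLens (List.ofFn α.shift) α.shift_antitone.sortedGE_ofFn

/-- Row `i` of the skew shape `outer / inner` consists of `α.rowLen i` consecutive boxes. -/
theorem mem_cells (α : Ribbon m) (r c : ℕ) :
    (r, c) ∈ α.outer.cells \ α.inner.cells ↔
      ∃ h : r < m, α.shift ⟨r, h⟩ ≤ c ∧ c < α.shift ⟨r, h⟩ + α.rowLen ⟨r, h⟩ := by
  rw [Finset.mem_sdiff, YoungDiagram.mem_cells, YoungDiagram.mem_cells, outer, inner,
    YoungDiagram.mem_ofRowLens, YoungDiagram.mem_ofRowLens]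
  by_cases h : r < m
  · simp [h, and_comm]
  · simp [h]

theorem inner_le_outer (α : Ribbon m) : α.inner ≤ α.outer := by
  rintro ⟨r, c⟩ h
  change (r, c) ∈ α.inner at h
  rw [inner, YoungDiagram.mem_ofRowLens] at h
  rw [outer, YoungDiagram.mem_ofRowLens]
  obtain ⟨h1, h2⟩ := h
  simp only [List.length_ofFn] at h1
  simp only [List.getElem_ofFn] at h2
  refine ⟨by simpa using h1, ?_⟩
  simp only [List.getElem_ofFn]
  omega

/-- The Schur support `[α]` of a ribbon. -/
def support (α : Ribbon m) : Set YoungDiagram := schurSupport α.outer α.inner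

/-- The ribbon `α_π = (α_{π⁻¹(1)}, …, α_{π⁻¹(m)})`. -/
def perm (α : Ribbon m) (π : Equiv.Perm (Fin m)) : Ribbon m where
  rowLen i := α.rowLen (π⁻¹ i)
  two_le i := α.two_le (π⁻¹ i)

def HasFullEquivalenceClass (α : Ribbon m) : Prop :=
  ∀ π : Equiv.Perm (Fin m), α.support = (α.perm π).support

/-- The number `m - j - 2` for the `j`-th row in the numbering `1, …, m`. Rows are numbered from
`0` here, so that `j : Fin m` stands for the row with number `j + 1`. -/
def slack (j : Fin m) : ℤ := (m : ℤ) - ((j.val : ℤ) + 1) - 2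

/-- The set of all `k` such that `∑_{i ≤ j, α_i < k} (k - α_i) ≤ m - j - 2`. -/
def necSet (α : Ribbon m) (j : Fin m) : Set ℕ :=
  {k | ∑ i ∈ Finset.univ.filter (fun i => i ≤ j ∧ α.rowLen i < k), ((k : ℤ) - α.rowLen i) ≤ slack j}

/-- The number `N_j`, the maximum of `necSet`. -/
noncomputable def necMax (α : Ribbon m) (j : Fin m) : ℕ := sSup (α.necSet j)

/-- The maximum exists for each row `j ≤ m - 2` in the numbering `1, …, m`. -/
theorem isGreatest_necMax (α : Ribbon m) (j : Fin m) (hj : j.val + 2 < m) :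
    IsGreatest (α.necSet j) (α.necMax j) := by
  have hs : 0 ≤ slack j := by unfold slack; omega
  have hne : (α.necSet j).Nonempty := by
    refine ⟨0, ?_⟩
    simpa [necSet] using hs
  have hb : BddAbove (α.necSet j) := by
    refine ⟨α.rowLen j + m, ?_⟩
    intro k hk
    by_contra! hlt
    have hmem : j ∈ Finset.univ.filter (fun i => i ≤ j ∧ α.rowLen i < k) := by
      simp only [Finset.mem_filter, Finset.mem_univ, true_and]
      exact ⟨le_rfl, by omega⟩
    have h1 := Finset.single_le_sum (f := fun i => (k : ℤ) - α.rowLen i) (fun i hi => by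
      simp only [Finset.mem_filter] at hi
      have := hi.2.2
      simp only [sub_nonneg]
      exact_mod_cast this.le) hmem
    have h2 : ∑ i ∈ Finset.univ.filter (fun i => i ≤ j ∧ α.rowLen i < k),
      ((k : ℤ) - α.rowLen i) ≤ slack j := hk
    have h3 := h1.trans h2
    simp only [slack] at h3
    omega
  exact ⟨Nat.sSup_mem hne hb, fun k hk => le_csSup hb hk⟩

end Ribbon

/-! Rows and strips are numbered from 0; put n = m - 1 and J = j. The coefficient of s_ν in a ribbon
Schur function counts standard tableaux of shape ν with prescribed descents. Equivalently, it counts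
chains of horizontal strips of sizes α_0, …, α_n, growing from the empty diagram to ν, such that
each strip but the last has a box strictly above the lowest row of the next strip
(`Ribbon.mem_support_iff`). This is proved by matching two recurrences. On series, a ribbon times
h_b is the sum of two ribbons, with the row of length b either attached as a new row or merged into
the bottom row. On coefficients, Pieri's rule and the splitting of horizontal strips give the same
recurrence (`ribbonCoeff_add`). Linear independence of the Schur functions makes the expansion
unique.

The theorem compares the possible lengths of row J + 1 when ν has no lower row. Strips 0, …, J
cannot reach that row. Every later strip except the last must leave a box above it for the sake of
the next descent. Hence for α one gets ν_{J+1} ≤ ∑_{i>J} α_i - (n - J - 1)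
(`rowLen_add_le_of_ribbonCoeff_ne_zero`).

After the swap of rows J and J + 1, one box can be saved. Strip J has length α_{J+1} and strip J + 1
has the larger length α_J; its excess α_J - α_{J+1} goes into row J and pays for the next descent,
while row J + 1 still receives α_{J+1} boxes (`reachable_swap`). So row J + 1 can reach M = ∑_{i>J}
α_i - (n - J - 2), provided that rows 0, …, J can be raised to M. The n - J - 2 boxes which later
strips must leave above row J + 1 are available for this. They suffice when ∑_{i≤J} max(M - α_i, 0)
≤ n - J - 2, which holds if M ≤ N_j (`exists_ribbonCoeff_swap_ne_zero`). Thus N_j ≥ M would yield a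
shape in exactly one of the two supports. -/

namespace YoungDiagram

/-! ### Young diagrams through their row lengths -/

theorem ext_rowLen {lam mu : YoungDiagram} (h : ∀ i, lam.rowLen i = mu.rowLen i) : lam = mu := by
  ext ⟨i, j⟩
  rw [mem_cells, mem_cells, mem_iff_lt_rowLen, mem_iff_lt_rowLen, h]

theorem le_iff_rowLen {lam mu : YoungDiagram} :
    lam ≤ mu ↔ ∀ i, lam.rowLen i ≤ mu.rowLen i := by
  constructor
  · intro h i
    by_contra! hlt
    have h1 : (i, mu.rowLen i) ∈ lam := mem_iff_lt_rowLen.2 hlt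
    have h2 : (i, mu.rowLen i) ∈ mu := h h1
    exact lt_irrefl _ (mem_iff_lt_rowLen.1 h2)
  · rintro h ⟨i, j⟩ hc
    exact mem_iff_lt_rowLen.2 ((mem_iff_lt_rowLen.1 hc).trans_le (h i))

@[simp]
theorem rowLen_bot (i : ℕ) : (⊥ : YoungDiagram).rowLen i = 0 := by
  by_contra h
  have : (i, 0) ∈ (⊥ : YoungDiagram) := mem_iff_lt_rowLen.2 (Nat.pos_of_ne_zero h)
  exact notMem_bot _ this

theorem rowLen_colLen_zero (mu : YoungDiagram) : mu.rowLen (mu.colLen 0) = 0 := by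
  by_contra h
  have : (mu.colLen 0, 0) ∈ mu := mem_iff_lt_rowLen.2 (Nat.pos_of_ne_zero h)
  exact lt_irrefl _ (mem_iff_lt_colLen.1 this)

theorem exists_rowLen_eq_zero (mu : YoungDiagram) : ∃ N, mu.rowLen N = 0 :=
  ⟨_, mu.rowLen_colLen_zero⟩

theorem rowLen_eq_zero_of_le {mu : YoungDiagram} {N i : ℕ} (h : mu.rowLen N = 0) (hi : N ≤ i) :
    mu.rowLen i = 0 :=
  Nat.le_zero.1 (h ▸ mu.rowLen_anti N i hi)

theorem card_eq_sum_rowLen (mu : YoungDiagram) {N : ℕ} (h : mu.rowLen N = 0) :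
    mu.card = ∑ i ∈ Finset.range N, mu.rowLen i := by
  have : mu.cells = (Finset.range N).biUnion mu.row := by
    ext ⟨i, j⟩
    simp only [Finset.mem_biUnion, Finset.mem_range, mem_row_iff, mem_cells]
    constructor
    · intro hc
      refine ⟨i, ?_, hc, rfl⟩
      by_contra! hi
      have := mem_iff_lt_rowLen.1 hc
      rw [rowLen_eq_zero_of_le h hi] at this
      omega
    · rintro ⟨_, _, hc, _⟩
      exact hc
  rw [YoungDiagram.card, this, Finset.card_biUnion]
  · simp [rowLen_eq_card]
  · intro a _ b _ hab
    rw [Function.onFun, Finset.disjoint_left]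
    rintro ⟨i, j⟩ h1 h2
    rw [mem_row_iff] at h1 h2
    exact hab (h1.2.symm.trans h2.2)

/-- The Young diagram with row lengths `f 0, f 1, …`. -/
def ofFun (f : ℕ → ℕ) (hf : Antitone f) (h0 : ∃ N, f N = 0) : YoungDiagram where
  cells := (Finset.range (Nat.find h0) ×ˢ Finset.range (f 0)).filter fun c => c.2 < f c.1
  isLowerSet := by
    rintro ⟨i, j⟩ ⟨i', j'⟩ ⟨hi, hj⟩ hc
    simp only [Finset.coe_filter, Finset.mem_product, Finset.mem_range, Set.mem_ofPred_eq] at hc ⊢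
    simp only at hi hj
    have := hf hi
    omega

@[simp]
theorem rowLen_ofFun (f : ℕ → ℕ) (hf : Antitone f) (h0 : ∃ N, f N = 0) (i : ℕ) :
    (ofFun f hf h0).rowLen i = f i := by
  have key : ∀ j, j < (ofFun f hf h0).rowLen i ↔ j < f i := by
    intro j
    rw [← mem_iff_lt_rowLen]
    change (i, j) ∈ (ofFun f hf h0).cells ↔ _
    simp only [ofFun, Finset.mem_filter, Finset.mem_product, Finset.mem_range]
    have h1 := hf (Nat.zero_le i)
    constructor
    · exact fun h => h.2
    · intro h
      refine ⟨⟨?_, by omega⟩, h⟩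
      by_contra! hle
      have h2 := hf hle
      rw [Nat.find_spec h0] at h2
      omega
  apply le_antisymm
  · by_contra! h
    exact lt_irrefl _ ((key _).1 h)
  · by_contra! h
    exact lt_irrefl _ ((key _).2 h)

theorem card_mono {lam mu : YoungDiagram} (h : lam ≤ mu) : lam.card ≤ mu.card :=
  Finset.card_le_card h

theorem eq_of_le_of_card {lam mu : YoungDiagram} (h : lam ≤ mu) (hc : lam.card = mu.card) :
    lam = mu :=
  YoungDiagram.ext (Finset.eq_of_subset_of_card_le h hc.ge)

@[simp]
theorem card_eq_zero_iff {lam : YoungDiagram} : lam.card = 0 ↔ lam = ⊥ := by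
  constructor
  · intro h
    exact (eq_of_le_of_card bot_le (by rw [h]; rfl)).symm
  · rintro rfl
    rfl

theorem rowLen_le_card (mu : YoungDiagram) (i : ℕ) : mu.rowLen i ≤ mu.card := by
  rw [rowLen_eq_card]
  exact Finset.card_le_card (Finset.filter_subset _ _)

theorem rowLen_card (mu : YoungDiagram) : mu.rowLen mu.card = 0 := by
  apply rowLen_eq_zero_of_le mu.rowLen_colLen_zero
  rw [colLen_eq_card]
  exact Finset.card_le_card (Finset.filter_subset _ _)

theorem finite_card_eq (n : ℕ) : {mu : YoungDiagram | mu.card = n}.Finite := by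
  refine Set.Finite.of_injOn (f := YoungDiagram.cells)
    (t := ((Finset.range n ×ˢ Finset.range n).powerset : Set (Finset (ℕ × ℕ)))) ?_ ?_
    (Finset.finite_toSet _)
  · rintro mu rfl
    rw [Finset.mem_coe, Finset.mem_powerset]
    rintro ⟨i, j⟩ hc
    have h1 := mem_iff_lt_rowLen.1 ((mem_cells _).1 hc)
    rw [Finset.mem_product, Finset.mem_range, Finset.mem_range]
    refine ⟨?_, h1.trans_le (mu.rowLen_le_card i)⟩
    by_contra! h
    rw [rowLen_eq_zero_of_le mu.rowLen_card h] at h1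
    omega
  · intro a _ b _ h
    exact YoungDiagram.ext h

/-- The Young diagrams with `n` boxes. -/
noncomputable def ofCard (n : ℕ) : Finset YoungDiagram := (finite_card_eq n).toFinset

@[simp]
theorem mem_ofCard {n : ℕ} {mu : YoungDiagram} : mu ∈ ofCard n ↔ mu.card = n := by
  simp [ofCard]

/-! ### Horizontal strips and the commutation of adding and removing them -/

/-- The skew shape `mu / lam` is a horizontal strip. -/
def HStrip (lam mu : YoungDiagram) : Prop :=
  ∀ i, lam.rowLen i ≤ mu.rowLen i ∧ mu.rowLen (i + 1) ≤ lam.rowLen i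

theorem HStrip.le {lam mu : YoungDiagram} (h : HStrip lam mu) : lam ≤ mu :=
  le_iff_rowLen.2 fun i => (h i).1

open Classical in
/-- The diagrams obtained from `lam` by adding a horizontal strip of size `k`. -/
noncomputable def ups (lam : YoungDiagram) (k : ℕ) : Finset YoungDiagram :=
  (ofCard (lam.card + k)).filter (HStrip lam)

open Classical in
/-- The diagrams obtained from `mu` by removing a horizontal strip of size `k`. -/
noncomputable def downs (mu : YoungDiagram) (k : ℕ) : Finset YoungDiagram :=
  if k ≤ mu.card then (ofCard (mu.card - k)).filter (HStrip · mu) else ∅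

theorem mem_ups {lam mu : YoungDiagram} {k : ℕ} :
    mu ∈ ups lam k ↔ mu.card = lam.card + k ∧ HStrip lam mu := by
  simp [ups]

theorem mem_downs {lam mu : YoungDiagram} {k : ℕ} :
    lam ∈ downs mu k ↔ mu.card = lam.card + k ∧ HStrip lam mu := by
  unfold downs
  split_ifs with h
  · simp only [Finset.mem_filter, mem_ofCard]
    refine and_congr_left fun _ => ?_
    omega
  · simp only [Finset.notMem_empty, false_iff, not_and]
    omega

theorem mem_downs_iff_mem_ups {lam mu : YoungDiagram} {k : ℕ} :
    lam ∈ downs mu k ↔ mu ∈ ups lam k := by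
  rw [mem_downs, mem_ups]

/-- The local growth rule: for `lam` and `nu` of which `rho` is a common lower neighbour, the common
upper neighbour with `t` additional boxes in row `0`. -/
def growUp (lam nu rho : YoungDiagram) (t : ℕ) : ℕ → ℕ
  | 0 => max (lam.rowLen 0) (nu.rowLen 0) + t
  | i + 1 => max (lam.rowLen (i + 1)) (nu.rowLen (i + 1)) + min (lam.rowLen i) (nu.rowLen i)
      - rho.rowLen i

/-- The inverse local growth rule. -/
def growDown (lam nu mu : YoungDiagram) (i : ℕ) : ℕ :=
  max (lam.rowLen (i + 1)) (nu.rowLen (i + 1)) + min (lam.rowLen i) (nu.rowLen i)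
    - mu.rowLen (i + 1)

/-- This is the local rule of Robinson–Schensted–Knuth growth diagrams. The size identity follows by
summing the rule over the rows, since max + min of two row lengths is their sum. -/
theorem exists_growUp {lam nu rho : YoungDiagram} (hl : HStrip rho lam) (hn : HStrip rho nu)
    (t : ℕ) : ∃ mu : YoungDiagram, HStrip lam mu ∧ HStrip nu mu ∧
      (mu.rowLen 0 = max (lam.rowLen 0) (nu.rowLen 0) + t) ∧
      (∀ i, mu.rowLen (i + 1) + rho.rowLen i =
        max (lam.rowLen (i + 1)) (nu.rowLen (i + 1)) + min (lam.rowLen i) (nu.rowLen i)) ∧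
      mu.card + rho.card = lam.card + nu.card + t := by
  have hb : ∀ i, growUp lam nu rho t (i + 1) + rho.rowLen i =
      max (lam.rowLen (i + 1)) (nu.rowLen (i + 1)) + min (lam.rowLen i) (nu.rowLen i) := by
    intro i
    have h1 := hl i
    have h2 := hn i
    simp only [growUp]
    omega
  have hanti : Antitone (growUp lam nu rho t) := by
    refine antitone_nat_of_succ_le fun i => ?_
    have h1 := hl i
    have h2 := hn i
    have h3 := hb i
    cases i with
    | zero => simp only [growUp] at h3 ⊢; omega
    | succ i =>
      have h4 := hb i
      have h5 := hl (i + 1)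
      have h6 := hn (i + 1)
      have h7 := hl i
      have h8 := hn i
      omega
  obtain ⟨N1, hN1⟩ := lam.exists_rowLen_eq_zero
  obtain ⟨N2, hN2⟩ := nu.exists_rowLen_eq_zero
  obtain ⟨N, hN, hN'⟩ : ∃ N, lam.rowLen N = 0 ∧ nu.rowLen N = 0 :=
    ⟨max N1 N2, rowLen_eq_zero_of_le hN1 (le_max_left _ _),
      rowLen_eq_zero_of_le hN2 (le_max_right _ _)⟩
  have hz : growUp lam nu rho t (N + 1) = 0 := by
    have h1 := hb N
    have h2 := rowLen_eq_zero_of_le hN N.le_succ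
    have h3 := rowLen_eq_zero_of_le hN' N.le_succ
    simp only [Nat.succ_eq_add_one] at h2 h3
    omega
  refine ⟨ofFun _ hanti ⟨_, hz⟩, ?_, ?_, by simp [growUp], by simpa using hb, ?_⟩
  · intro i
    rw [rowLen_ofFun, rowLen_ofFun]
    have h1 := hb i
    have h2 := hl i
    have h3 := hn i
    refine ⟨?_, by omega⟩
    cases i with
    | zero => simp only [growUp]; omega
    | succ i =>
      have h4 := hb i
      have h7 := hl i
      have h8 := hn i
      omega
  · intro i
    rw [rowLen_ofFun, rowLen_ofFun]
    have h1 := hb i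
    have h2 := hl i
    have h3 := hn i
    refine ⟨?_, by omega⟩
    cases i with
    | zero => simp only [growUp]; omega
    | succ i =>
      have h4 := hb i
      have h7 := hl i
      have h8 := hn i
      omega
  · have hrN : rho.rowLen N = 0 := by have := hl N; omega
    rw [card_eq_sum_rowLen (N := N + 1) _ (by simpa using hz), card_eq_sum_rowLen rho hrN,
      card_eq_sum_rowLen lam hN, card_eq_sum_rowLen nu hN', Finset.sum_range_succ']
    simp only [rowLen_ofFun]
    have h1 : ∑ i ∈ Finset.range N, growUp lam nu rho t (i + 1) +
        ∑ i ∈ Finset.range N, rho.rowLen i =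
        ∑ i ∈ Finset.range N, max (lam.rowLen (i + 1)) (nu.rowLen (i + 1)) +
        ∑ i ∈ Finset.range N, min (lam.rowLen i) (nu.rowLen i) := by
      rw [← Finset.sum_add_distrib, ← Finset.sum_add_distrib]
      exact Finset.sum_congr rfl fun i _ => hb i
    have h2 : ∑ i ∈ Finset.range N, max (lam.rowLen (i + 1)) (nu.rowLen (i + 1)) +
        max (lam.rowLen 0) (nu.rowLen 0) =
        ∑ i ∈ Finset.range N, max (lam.rowLen i) (nu.rowLen i) := by
      rw [← Finset.sum_range_succ' (fun i => max (lam.rowLen i) (nu.rowLen i)),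
        Finset.sum_range_succ, hN, hN']
      simp
    have h3 : ∑ i ∈ Finset.range N, max (lam.rowLen i) (nu.rowLen i) +
        ∑ i ∈ Finset.range N, min (lam.rowLen i) (nu.rowLen i) =
        ∑ i ∈ Finset.range N, lam.rowLen i + ∑ i ∈ Finset.range N, nu.rowLen i := by
      rw [← Finset.sum_add_distrib, ← Finset.sum_add_distrib]
      exact Finset.sum_congr rfl fun i _ => by omega
    simp only [growUp] at h1 ⊢
    omega

theorem exists_growDown {lam nu mu : YoungDiagram} (hl : HStrip lam mu) (hn : HStrip nu mu) :
    ∃ rho : YoungDiagram, HStrip rho lam ∧ HStrip rho nu ∧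
      (∀ i, mu.rowLen (i + 1) + rho.rowLen i =
        max (lam.rowLen (i + 1)) (nu.rowLen (i + 1)) + min (lam.rowLen i) (nu.rowLen i)) := by
  have hb : ∀ i, mu.rowLen (i + 1) + growDown lam nu mu i =
      max (lam.rowLen (i + 1)) (nu.rowLen (i + 1)) + min (lam.rowLen i) (nu.rowLen i) := by
    intro i
    have h1 := hl i
    have h2 := hn i
    simp only [growDown]
    omega
  have hanti : Antitone (growDown lam nu mu) := by
    refine antitone_nat_of_succ_le fun i => ?_
    have h1 := hl i
    have h2 := hn i
    have h3 := hb i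
    have h4 := hb (i + 1)
    have h5 := hl (i + 1 + 1)
    have h6 := hn (i + 1 + 1)
    omega
  obtain ⟨N, hN⟩ := mu.exists_rowLen_eq_zero
  have hz : growDown lam nu mu N = 0 := by
    have h1 := hb N
    have h2 := hl N
    have h3 := hn N
    have h4 := hl (N + 1)
    have h5 := hn (N + 1)
    have h6 := mu.rowLen_anti N (N + 1) (by omega)
    omega
  refine ⟨ofFun _ hanti ⟨N, hz⟩, ?_, ?_, by simpa using hb⟩
  all_goals
    intro i
    rw [rowLen_ofFun]
    have h1 := hb i
    have h2 := hl i
    have h3 := hn i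
    have h4 := hl (i + 1)
    have h5 := hn (i + 1)
    omega

/-- With U_k and D_l for adding and removing strips, D_l U_k = ∑_t U_{k-t} D_{l-t}. The growth rule
matches the pairs (mu, nu) with the triples (t, rho, nu), where t is the excess of row 0 of mu over
the longer row 0 of lam and nu. -/
theorem sum_ups_sum_downs {M : Type*} [AddCommMonoid M] (F : YoungDiagram → M)
    (lam : YoungDiagram) (k l : ℕ) :
    ∑ mu ∈ ups lam k, ∑ nu ∈ downs mu l, F nu =
      ∑ t ∈ Finset.range (min k l + 1), ∑ rho ∈ downs lam (l - t), ∑ nu ∈ ups rho (k - t),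
        F nu := by
  simp_rw [Finset.sum_sigma' (ups lam k), Finset.sum_sigma' (downs lam _),
    Finset.sum_sigma' (Finset.range _)]
  have key : ∀ p : (_ : YoungDiagram) × YoungDiagram,
      p ∈ (ups lam k).sigma (fun mu => downs mu l) →
      ∃ q : (_ : ℕ) × (_ : YoungDiagram) × YoungDiagram,
        q ∈ (Finset.range (min k l + 1)).sigma
          (fun t => (downs lam (l - t)).sigma fun rho => ups rho (k - t)) ∧ q.2.2 = p.2 ∧
        (p.1.rowLen 0 = max (lam.rowLen 0) (p.2.rowLen 0) + q.1) ∧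
        (∀ i, p.1.rowLen (i + 1) + q.2.1.rowLen i =
          max (lam.rowLen (i + 1)) (p.2.rowLen (i + 1)) + min (lam.rowLen i) (p.2.rowLen i)) := by
    rintro ⟨mu, nu⟩ hp
    simp only [Finset.mem_sigma, mem_ups, mem_downs] at hp
    obtain ⟨⟨hc1, hl⟩, hc2, hn⟩ := hp
    obtain ⟨rho, h1, h2, h3⟩ := exists_growDown hl hn
    obtain ⟨t, ht⟩ : ∃ t, mu.rowLen 0 = max (lam.rowLen 0) (nu.rowLen 0) + t :=
      Nat.exists_eq_add_of_le (max_le (hl 0).1 (hn 0).1)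
    obtain ⟨mu', g1, g2, g3, g4, g5⟩ := exists_growUp h1 h2 t
    -- The rule determines `mu` from `t` and `rho`, so growing up again returns `mu`; this transfers
    -- the size identity, from which the bounds on `t` follow.
    have hmu : mu' = mu := by
      refine ext_rowLen fun i => ?_
      cases i with
      | zero => rw [g3, ht]
      | succ i => have := g4 i; have := h3 i; omega
    subst hmu
    have c1 := card_mono h1.le
    have c2 := card_mono h2.le
    refine ⟨⟨t, rho, nu⟩, ?_, rfl, ht, h3⟩
    simp only [Finset.mem_sigma, mem_ups, mem_downs, Finset.mem_range]
    exact ⟨by omega, ⟨by omega, h1⟩, by omega, h2⟩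
  choose g hg1 hg2 hg3 hg4 using key
  refine Finset.sum_bij g hg1 ?_ ?_ ?_
  · rintro ⟨mu, nu⟩ hp ⟨mu', nu'⟩ hp' h
    have e2 := (hg2 _ hp).symm.trans ((congrArg (fun q => q.2.2) h).trans (hg2 _ hp'))
    simp only at e2
    subst e2
    have e1 : mu = mu' := by
      refine ext_rowLen fun i => ?_
      cases i with
      | zero =>
        have a1 := hg3 _ hp
        have a2 := hg3 _ hp'
        rw [h] at a1
        simp only at a1 a2
        omega
      | succ i =>
        have a1 := hg4 _ hp i
        have a2 := hg4 _ hp' i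
        rw [h] at a1
        simp only at a1 a2
        omega
    subst e1
    rfl
  · rintro ⟨t, rho, nu⟩ hq
    simp only [Finset.mem_sigma, mem_ups, mem_downs, Finset.mem_range] at hq
    obtain ⟨ht, ⟨c1, h1⟩, c2, h2⟩ := hq
    obtain ⟨mu, g1, g2, g3, g4, g5⟩ := exists_growUp h1 h2 t
    have hp : (⟨mu, nu⟩ : (_ : YoungDiagram) × YoungDiagram) ∈
        (ups lam k).sigma (fun mu => downs mu l) := by
      simp only [Finset.mem_sigma, mem_ups, mem_downs]
      exact ⟨⟨by omega, g1⟩, by omega, g2⟩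
    refine ⟨_, hp, ?_⟩
    have a1 := hg2 _ hp
    have a2 := hg3 _ hp
    have a3 := hg4 _ hp
    generalize g _ hp = q at a1 a2 a3
    obtain ⟨t', rho', nu'⟩ := q
    simp only at a1 a2 a3
    subst a1
    obtain rfl : t' = t := by omega
    obtain rfl : rho' = rho := ext_rowLen fun i => by
      have := a3 i
      have := g4 i
      omega
    rfl
  · intro p hp
    rw [hg2 _ hp]

end YoungDiagram

/-! ### Branching and Pieri's rule for Schur functions -/

open YoungDiagram MvPowerSeries

theorem mem_cells_sdiff_bot {mu : YoungDiagram} {c : ℕ × ℕ} :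
    c ∈ mu.cells \ (⊥ : YoungDiagram).cells ↔ c ∈ mu := by simp

namespace SkewTableau

theorem content_bot {mu : YoungDiagram} (T : SkewTableau mu ⊥) :
    T.content = ∑ b ∈ mu.cells, Finsupp.single (T.entry b.1 b.2) 1 := by
  simp [content]

theorem content_pos {lam mu : YoungDiagram} (T : SkewTableau lam mu) {i j : ℕ}
    (h : (i, j) ∈ lam.cells \ mu.cells) : 0 < T.content (T.entry i j) := by
  unfold content
  rw [Finsupp.finsetSum_apply]
  refine lt_of_lt_of_le (?_ : 0 < 1) (Finset.single_le_sum (f := fun b : ℕ × ℕ =>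
    (Finsupp.single (T.entry b.1 b.2) 1 : ℕ →₀ ℕ) (T.entry i j)) (fun _ _ => Nat.zero_le _) h
    |> le_trans (by simp))
  exact one_pos

theorem entry_lt {lam mu : YoungDiagram} (T : SkewTableau lam mu) {N : ℕ}
    (hd : ∀ v, N ≤ v → T.content v = 0) {i j : ℕ} (h : (i, j) ∈ lam.cells \ mu.cells) :
    T.entry i j < N := by
  by_contra! hle
  have := T.content_pos h
  rw [hd _ hle] at this
  exact lt_irrefl _ this

/-- The shape of the boxes with entry less than `N`. -/
def shapeLT {mu : YoungDiagram} (T : SkewTableau mu ⊥) (N : ℕ) : YoungDiagram where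
  cells := mu.cells.filter fun c => T.entry c.1 c.2 < N
  isLowerSet := by
    rintro ⟨i, j⟩ ⟨i', j'⟩ ⟨hi, hj⟩ hc
    simp only [Finset.coe_filter, mem_cells, Set.mem_ofPred_eq] at hc ⊢
    simp only at hi hj
    obtain ⟨hm, hlt⟩ := hc
    have hm1 : (i, j') ∈ mu := mu.up_left_mem le_rfl hj hm
    have hm2 : (i', j') ∈ mu := mu.up_left_mem hi hj hm
    refine ⟨hm2, lt_of_le_of_lt ?_ hlt⟩
    have h1 : T.entry i j' ≤ T.entry i j := by
      rcases hj.eq_or_lt with rfl | hj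
      · exact le_rfl
      · exact T.row_weak hj (mem_cells_sdiff_bot.2 hm1) (mem_cells_sdiff_bot.2 hm)
    have h2 : T.entry i' j' ≤ T.entry i j' := by
      rcases hi.eq_or_lt with rfl | hi
      · exact le_rfl
      · exact (T.col_strict hi (mem_cells_sdiff_bot.2 hm2) (mem_cells_sdiff_bot.2 hm1)).le
    exact h2.trans h1

theorem mem_shapeLT {mu : YoungDiagram} (T : SkewTableau mu ⊥) (N i j : ℕ) :
    (i, j) ∈ T.shapeLT N ↔ (i, j) ∈ mu ∧ T.entry i j < N := by
  rw [← mem_cells]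
  simp [shapeLT]

open Classical in
/-- The restriction of a tableau to the boxes with entry less than `N`. -/
noncomputable def restrictLT {mu : YoungDiagram} (T : SkewTableau mu ⊥) (N : ℕ) :
    SkewTableau (T.shapeLT N) ⊥ where
  entry i j := if (i, j) ∈ T.shapeLT N then T.entry i j else 0
  row_weak {i j₁ j₂} h h1 h2 := by
    rw [mem_cells_sdiff_bot] at h1 h2
    rw [if_pos h1, if_pos h2]
    exact T.row_weak h (mem_cells_sdiff_bot.2 ((T.mem_shapeLT N _ _).1 h1).1)
      (mem_cells_sdiff_bot.2 ((T.mem_shapeLT N _ _).1 h2).1)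
  col_strict {i₁ i₂ j} h h1 h2 := by
    rw [mem_cells_sdiff_bot] at h1 h2
    rw [if_pos h1, if_pos h2]
    exact T.col_strict h (mem_cells_sdiff_bot.2 ((T.mem_shapeLT N _ _).1 h1).1)
      (mem_cells_sdiff_bot.2 ((T.mem_shapeLT N _ _).1 h2).1)
  zeros {i j} h := by
    rw [mem_cells_sdiff_bot] at h
    rw [if_neg h]

open Classical in
/-- Fill the boxes of a horizontal strip with an entry that exceeds all other entries. -/
noncomputable def extend {rho mu : YoungDiagram} (h : HStrip rho mu) (N : ℕ)
    (T : SkewTableau rho ⊥) (hT : ∀ i j, (i, j) ∈ rho → T.entry i j < N) : SkewTableau mu ⊥ where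
  entry i j := if (i, j) ∈ rho then T.entry i j else if (i, j) ∈ mu then N else 0
  row_weak {i j₁ j₂} hj h1 h2 := by
    rw [mem_cells_sdiff_bot] at h1 h2
    rw [if_pos h1, if_pos h2]
    by_cases g2 : (i, j₂) ∈ rho
    · have g1 : (i, j₁) ∈ rho := rho.up_left_mem le_rfl hj.le g2
      rw [if_pos g1, if_pos g2]
      exact T.row_weak hj (mem_cells_sdiff_bot.2 g1) (mem_cells_sdiff_bot.2 g2)
    · rw [if_neg g2]
      split_ifs with g1
      · exact (hT _ _ g1).le
      · exact le_rfl
  col_strict {i₁ i₂ j} hi h1 h2 := by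
    rw [mem_cells_sdiff_bot] at h1 h2
    have g1 : (i₁, j) ∈ rho := by
      have a1 := mem_iff_lt_rowLen.1 h2
      have a2 := mu.rowLen_anti (i₁ + 1) i₂ hi
      have a3 := (h i₁).2
      exact mem_iff_lt_rowLen.2 (by omega)
    rw [if_pos g1]
    split_ifs with g2
    · exact T.col_strict hi (mem_cells_sdiff_bot.2 g1) (mem_cells_sdiff_bot.2 g2)
    · exact hT _ _ g1
  zeros {i j} hm := by
    rw [mem_cells_sdiff_bot] at hm
    rw [if_neg (fun hr => hm (h.le hr)), if_neg hm]

theorem content_eq_of_agree {rho mu : YoungDiagram} (h : rho ≤ mu) (N : ℕ)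
    (T' : SkewTableau rho ⊥) (T : SkewTableau mu ⊥)
    (h1 : ∀ i j, (i, j) ∈ rho → T.entry i j = T'.entry i j)
    (h2 : ∀ i j, (i, j) ∈ mu → (i, j) ∉ rho → T.entry i j = N) :
    T.content = T'.content + Finsupp.single N (mu.card - rho.card) := by
  have hs : rho.cells ⊆ mu.cells := cells_subset_iff.2 h
  rw [content_bot, content_bot, ← Finset.sum_sdiff hs, add_comm]
  congr 1
  · refine Finset.sum_congr rfl ?_
    rintro ⟨i, j⟩ hc
    rw [h1 i j ((mem_cells _).1 hc)]
  · rw [Finset.sum_congr rfl (g := fun _ => Finsupp.single N 1), Finset.sum_const,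
      Finset.card_sdiff_of_subset hs, Finsupp.smul_single]
    · simp
    · rintro ⟨i, j⟩ hc
      rw [Finset.mem_sdiff, mem_cells, mem_cells] at hc
      rw [h2 i j hc.1 hc.2]

end SkewTableau

/-- The boxes carrying the largest admissible entry N form a horizontal strip of size l. Deleting
them leaves a tableau of content d, and the strip can always be put back. -/
theorem schur_branching (mu : YoungDiagram) (d : ℕ →₀ ℕ) (N l : ℕ)
    (hd : ∀ v, N ≤ v → d v = 0) :
    coeff (d + Finsupp.single N l) (schur mu) = ∑ rho ∈ downs mu l, coeff d (schur rho) := by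
  have _ := fun rho : {rho // rho ∈ downs mu l} => SkewTableau.finite_content rho.1 ⊥ d
  change ((Nat.card {T : SkewTableau mu ⊥ // T.content = d + Finsupp.single N l} : ℕ) : ℤ) =
    ∑ rho ∈ downs mu l, ((Nat.card {T : SkewTableau rho ⊥ // T.content = d} : ℕ) : ℤ)
  rw [← Nat.cast_sum, ← Finset.sum_coe_sort, ← Nat.card_sigma]
  congr 1
  symm
  have hlt : ∀ {rho : YoungDiagram} (T : {T : SkewTableau rho ⊥ // T.content = d}) (i j : ℕ),
      (i, j) ∈ rho → T.1.entry i j < N := fun T i j h =>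
    T.1.entry_lt (by rw [T.2]; exact hd) (mem_cells_sdiff_bot.2 h)
  refine Nat.card_eq_of_bijective
    (fun p : (Σ rho : {rho // rho ∈ downs mu l}, {T : SkewTableau rho.1 ⊥ // T.content = d}) =>
      (⟨p.2.1.extend (mem_downs.1 p.1.2).2 N (hlt p.2), ?_⟩ :
        {T : SkewTableau mu ⊥ // T.content = d + Finsupp.single N l})) ⟨?_, ?_⟩
  · obtain ⟨⟨rho, hr⟩, T, rfl⟩ := p
    rw [mem_downs] at hr
    rw [SkewTableau.content_eq_of_agree hr.2.le N T]
    · rw [hr.1, Nat.add_sub_cancel_left]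
    · intro i j h
      simp [SkewTableau.extend, h]
    · intro i j h h'
      simp [SkewTableau.extend, h, h']
  · rintro ⟨⟨rho, hr⟩, T, hT⟩ ⟨⟨rho', hr'⟩, T', hT'⟩ h
    have he : ∀ i j, (T.extend (mem_downs.1 hr).2 N (hlt ⟨T, hT⟩)).entry i j =
        (T'.extend (mem_downs.1 hr').2 N (hlt ⟨T', hT'⟩)).entry i j := fun i j =>
      congrArg (fun S => SkewTableau.entry (Subtype.val S) i j) h
    have hm : ∀ {rho : YoungDiagram} (hr : rho ∈ downs mu l) (T : SkewTableau rho ⊥)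
        (hT : T.content = d) (i j : ℕ), (i, j) ∈ rho ↔ (i, j) ∈ mu ∧
          (T.extend (mem_downs.1 hr).2 N (hlt ⟨T, hT⟩)).entry i j < N := by
      intro rho hr T hT i j
      constructor
      · intro hc
        refine ⟨(mem_downs.1 hr).2.le hc, ?_⟩
        simpa [SkewTableau.extend, hc] using hlt ⟨T, hT⟩ i j hc
      · rintro ⟨h1, h2⟩
        by_contra hc
        simp [SkewTableau.extend, hc, h1] at h2
    obtain rfl : rho = rho' := by
      ext ⟨i, j⟩
      rw [mem_cells, mem_cells, hm hr T hT, hm hr' T' hT', he]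
    obtain rfl : T = T' := by
      ext i j
      by_cases hc : (i, j) ∈ rho
      · simpa [SkewTableau.extend, hc] using he i j
      · rw [T.zeros (by rwa [mem_cells_sdiff_bot]), T'.zeros (by rwa [mem_cells_sdiff_bot])]
    rfl
  · rintro ⟨T, hT⟩
    have hle : ∀ i j, (i, j) ∈ mu → T.entry i j < N + 1 := fun i j h =>
      T.entry_lt (fun v hv => by
        rw [hT, Finsupp.add_apply, hd v (by omega), Finsupp.single_eq_of_ne (by omega), add_zero])
        (mem_cells_sdiff_bot.2 h)
    have hs : HStrip (T.shapeLT N) mu := by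
      intro i
      constructor
      · exact le_iff_rowLen.1 (fun c hc => ((T.mem_shapeLT N c.1 c.2).1 hc).1) i
      · by_contra! hlt'
        have h1 : (i + 1, (T.shapeLT N).rowLen i) ∈ mu := mem_iff_lt_rowLen.2 hlt'
        have h2 : (i, (T.shapeLT N).rowLen i) ∈ mu := mu.up_left_mem (by omega) le_rfl h1
        have h3 := T.col_strict (Nat.lt_add_one i) (mem_cells_sdiff_bot.2 h2)
          (mem_cells_sdiff_bot.2 h1)
        have h4 := hle _ _ h1
        have h5 := (T.mem_shapeLT N i _).2 ⟨h2, by omega⟩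
        exact lt_irrefl _ (mem_iff_lt_rowLen.1 h5)
    have hc := SkewTableau.content_eq_of_agree hs.le N (T.restrictLT N) T
      (fun i j h => by simp [SkewTableau.restrictLT, h])
      (fun i j h h' => by
        have h1 := hle i j h
        have h2 : ¬ T.entry i j < N := fun h2 => h' ((T.mem_shapeLT N i j).2 ⟨h, h2⟩)
        omega)
    have hlt' : ∀ i j, (i, j) ∈ T.shapeLT N → (T.restrictLT N).entry i j < N := fun i j h => by
      simpa [SkewTableau.restrictLT, h] using ((T.mem_shapeLT N i j).1 h).2
    have hz : (T.restrictLT N).content N = 0 := by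
      rw [SkewTableau.content_bot, Finsupp.finsetSum_apply]
      refine Finset.sum_eq_zero ?_
      rintro ⟨i, j⟩ hb
      exact Finsupp.single_eq_of_ne (hlt' i j ((mem_cells _).1 hb)).ne'
    have hcard : mu.card - (T.shapeLT N).card = l := by
      have := DFunLike.congr_fun (hT.symm.trans hc) N
      simpa [hd N le_rfl, hz] using this.symm
    rw [hT, hcard] at hc
    have hc' := add_right_cancel hc
    have hcard' := card_mono hs.le
    refine ⟨⟨⟨T.shapeLT N, mem_downs.2 ⟨by omega, hs⟩⟩, T.restrictLT N, hc'.symm⟩, ?_⟩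
    refine Subtype.ext (SkewTableau.ext ?_)
    ext i j
    change (if (i, j) ∈ T.shapeLT N then (T.restrictLT N).entry i j
      else if (i, j) ∈ mu then N else 0) = T.entry i j
    split_ifs with h1 h2
    · simp [SkewTableau.restrictLT, h1]
    · have h3 := hle i j h2
      have h4 : ¬ T.entry i j < N := fun h4 => h1 ((T.mem_shapeLT N i j).2 ⟨h2, h4⟩)
      omega
    · exact (T.zeros (by rwa [mem_cells_sdiff_bot])).symm

/-- The complete homogeneous symmetric function. -/
noncomputable def hcomplete (k : ℕ) : MvPowerSeries ℕ ℤ := fun d => if d.degree = k then 1 else 0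

theorem coeff_hcomplete (k : ℕ) (d : ℕ →₀ ℕ) :
    coeff d (hcomplete k) = if d.degree = k then 1 else 0 := rfl

/-- The index t is the share of the exponent of variable N that goes to the second factor. -/
theorem sum_antidiagonal_add_single {M : Type*} [AddCommMonoid M] (d : ℕ →₀ ℕ) (N l : ℕ)
    (hd : d N = 0) (F : (ℕ →₀ ℕ) → (ℕ →₀ ℕ) → M) :
    ∑ p ∈ Finset.HasAntidiagonal.antidiagonal (d + Finsupp.single N l), F p.1 p.2 =
      ∑ t ∈ Finset.range (l + 1), ∑ p ∈ Finset.HasAntidiagonal.antidiagonal d,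
        F (p.1 + Finsupp.single N (l - t)) (p.2 + Finsupp.single N t) := by
  rw [Finset.sum_sigma']
  symm
  have hz : ∀ {p : (ℕ →₀ ℕ) × (ℕ →₀ ℕ)}, p.1 + p.2 = d → p.1 N = 0 ∧ p.2 N = 0 := by
    intro p hp
    have := DFunLike.congr_fun hp N
    rw [Finsupp.add_apply, hd] at this
    omega
  refine Finset.sum_bij (fun q _ => (q.2.1 + Finsupp.single N (l - q.1),
    q.2.2 + Finsupp.single N q.1)) ?_ ?_ ?_ ?_
  · rintro ⟨t, p⟩ hq
    simp only [Finset.mem_sigma, Finset.mem_range, Finset.HasAntidiagonal.mem_antidiagonal] at hq ⊢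
    rw [add_add_add_comm, hq.2, ← Finsupp.single_add, Nat.sub_add_cancel (by omega)]
  · rintro ⟨t, p1, p2⟩ hq ⟨t', p1', p2'⟩ hq' h
    simp only [Finset.mem_sigma, Finset.mem_range, Finset.HasAntidiagonal.mem_antidiagonal,
      Prod.mk.injEq]
      at hq hq' h
    have a1 := hz (p := (p1, p2)) hq.2
    have a2 := hz (p := (p1', p2')) hq'.2
    obtain rfl : t = t' := by
      have := DFunLike.congr_fun h.2 N
      simpa [a1.2, a2.2] using this
    obtain rfl := add_right_cancel h.1
    obtain rfl := add_right_cancel h.2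
    rfl
  · rintro ⟨p1, p2⟩ hp
    rw [Finset.HasAntidiagonal.mem_antidiagonal] at hp
    have hN := DFunLike.congr_fun hp N
    simp only [Finsupp.add_apply, hd, Finsupp.single_eq_same] at hN
    refine ⟨⟨p2 N, p1.erase N, p2.erase N⟩, ?_, ?_⟩
    · simp only [Finset.mem_sigma, Finset.mem_range, Finset.HasAntidiagonal.mem_antidiagonal]
      refine ⟨by omega, ?_⟩
      ext v
      have hv := DFunLike.congr_fun hp v
      by_cases h : v = N
      · subst h
        simp [hd]
      · simpa [Finsupp.erase_ne h, h] using hv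
    · refine Prod.ext ?_ ?_
      · simp only
        rw [show l - p2 N = p1 N by omega, Finsupp.erase_add_single]
      · simp only
        rw [Finsupp.erase_add_single]
  · intro _ _
    rfl

theorem degree_content {lam mu : YoungDiagram} (T : SkewTableau lam mu) :
    T.content.degree = (lam.cells \ mu.cells).card := by
  simp [SkewTableau.content, map_sum]

theorem schur_bot : schur ⊥ = 1 := by
  ext d
  rw [MvPowerSeries.coeff_one]
  change ((Nat.card {T : SkewTableau ⊥ ⊥ // T.content = d} : ℕ) : ℤ) = _
  split_ifs with h
  · subst h
    rw [Nat.cast_eq_one, Nat.card_eq_one_iff_unique]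
    refine ⟨⟨fun a b => Subtype.ext (SkewTableau.ext ?_)⟩, ⟨⟨⟨fun _ _ => 0, ?_, ?_, ?_⟩, ?_⟩⟩⟩
    · ext i j
      rw [a.1.zeros (by simp), b.1.zeros (by simp)]
    all_goals simp [SkewTableau.content]
  · rw [Nat.cast_eq_zero, Nat.card_eq_zero]
    refine Or.inl ⟨fun a => h ?_⟩
    rw [← a.2]
    simp [SkewTableau.content]

open Classical in
theorem coeff_zero_schur (mu : YoungDiagram) : coeff 0 (schur mu) = if mu = ⊥ then 1 else 0 := by
  split_ifs with h
  · subst h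
    rw [schur_bot]
    exact coeff_zero_one
  · change ((Nat.card {T : SkewTableau mu ⊥ // T.content = 0} : ℕ) : ℤ) = _
    rw [Nat.cast_eq_zero, Nat.card_eq_zero]
    refine Or.inl ⟨fun a => h ?_⟩
    have := degree_content a.1
    rw [a.2] at this
    rw [← card_eq_zero_iff]
    simpa using this.symm

/-- Induction on the number of variables. Branching in the last variable turns the left side into a
sum over strips added and then removed; the commutation relation reverses the order, the induction
hypothesis handles the added strips, and branching for `lam` reassembles the Cauchy product. -/
theorem pieri_coeff (N : ℕ) : ∀ (lam : YoungDiagram) (k : ℕ) (d : ℕ →₀ ℕ),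
    (∀ v, N ≤ v → d v = 0) → ∑ mu ∈ ups lam k, coeff d (schur mu) =
      ∑ p ∈ Finset.HasAntidiagonal.antidiagonal d,
        coeff p.1 (schur lam) * coeff p.2 (hcomplete k) := by
  induction N with
  | zero =>
    intro lam k d hd
    obtain rfl : d = 0 := Finsupp.ext fun v => hd v (Nat.zero_le v)
    simp only [coeff_zero_schur, Finsupp.antidiagonal_zero, Finset.sum_singleton, coeff_hcomplete]
    by_cases h : lam = ⊥ ∧ k = 0
    · obtain ⟨rfl, rfl⟩ := h
      have h0 : (⊥ : YoungDiagram) ∈ ups ⊥ 0 := mem_ups.2 ⟨rfl, fun i => by simp⟩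
      rw [Finset.sum_eq_single_of_mem _ h0 fun b _ hb => if_neg hb]
      simp
    · rw [Finset.sum_eq_zero]
      · simp only [map_zero]
        split_ifs <;> simp_all
      · rintro mu hmu
        refine if_neg ?_
        rintro rfl
        rw [mem_ups] at hmu
        have h3 : (⊥ : YoungDiagram).card = 0 := rfl
        exact h ⟨card_eq_zero_iff.1 (by omega), by omega⟩
  | succ N ih =>
    intro lam k d hd
    obtain ⟨d', l, hd', rfl⟩ : ∃ (d' : ℕ →₀ ℕ) (l : ℕ), (∀ v, N ≤ v → d' v = 0) ∧
        d = d' + Finsupp.single N l := by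
      refine ⟨d.erase N, d N, fun v hv => ?_, (Finsupp.erase_add_single N d).symm⟩
      by_cases h : v = N
      · subst h
        simp
      · rw [Finsupp.erase_ne h, hd v (by omega)]
    rw [Finset.sum_congr rfl fun mu _ => schur_branching mu d' N l hd', sum_ups_sum_downs,
      sum_antidiagonal_add_single d' N l (hd' N le_rfl)
        fun a b => coeff a (schur lam) * coeff b (hcomplete k)]
    -- The Cauchy product lets t run up to l, the commutation relation only up to min k l. The extra
    -- terms have t > k and vanish because h_k is homogeneous of degree k.
    have hsub : Finset.range (min k l + 1) ⊆ Finset.range (l + 1) :=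
      Finset.range_subset_range.2 (by omega)
    rw [← Finset.sum_subset hsub]
    · refine Finset.sum_congr rfl fun t ht => ?_
      rw [Finset.mem_range] at ht
      rw [Finset.sum_congr rfl fun rho _ => ih rho (k - t) d' hd', Finset.sum_comm]
      refine Finset.sum_congr rfl fun p hp => ?_
      rw [← Finset.sum_mul, schur_branching]
      · congr 1
        simp only [coeff_hcomplete, map_add, Finsupp.degree_single]
        congr 1
        apply propext
        omega
      · intro v hv
        rw [Finset.HasAntidiagonal.mem_antidiagonal] at hp
        have := DFunLike.congr_fun hp v
        rw [Finsupp.add_apply, hd' v hv] at this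
        omega
    · intro t _ ht
      rw [Finset.mem_range] at ht
      refine Finset.sum_eq_zero fun p _ => ?_
      simp only [coeff_hcomplete, map_add, Finsupp.degree_single]
      rw [if_neg, mul_zero]
      simp only [Finset.mem_range] at *
      omega

/-- Pieri's rule. -/
theorem schur_mul_hcomplete (lam : YoungDiagram) (k : ℕ) :
    schur lam * hcomplete k = ∑ mu ∈ ups lam k, schur mu := by
  ext d
  rw [MvPowerSeries.coeff_mul, map_sum]
  refine (pieri_coeff (d.support.sup id + 1) lam k d fun v hv => ?_).symm
  by_contra h
  have := Finset.le_sup (f := id) (Finsupp.mem_support_iff.2 h)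
  simp only [id] at this
  omega

/-! ### Ribbon fillings as lists of rows, and their product with a complete function -/

/-- The content of a word. -/
noncomputable def wordContent (w : List ℕ) : ℕ →₀ ℕ :=
  (w.map fun v => Finsupp.single v 1).sum

theorem wordContent_eq_toFinsupp (w : List ℕ) :
    wordContent w = Multiset.toFinsupp (w : Multiset ℕ) := by
  induction w with
  | nil => simp [wordContent]
  | cons v w ih =>
    rw [← Multiset.cons_coe, ← Multiset.singleton_add, Multiset.toFinsupp_add, ← ih,
      Multiset.toFinsupp_singleton]
    simp [wordContent]

theorem wordContent_append (v w : List ℕ) :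
    wordContent (v ++ w) = wordContent v + wordContent w := by
  simp [wordContent]

theorem wordContent_eq_iff_perm {v w : List ℕ} : wordContent v = wordContent w ↔ v.Perm w := by
  rw [wordContent_eq_toFinsupp, wordContent_eq_toFinsupp, EmbeddingLike.apply_eq_iff_eq,
    Multiset.coe_eq_coe]

theorem degree_wordContent (w : List ℕ) : (wordContent w).degree = w.length := by
  induction w with
  | nil => simp [wordContent]
  | cons v w ih =>
    rw [← List.singleton_append, wordContent_append, map_add, ih]
    simp [wordContent, add_comm]

theorem finite_wordContent (d : ℕ →₀ ℕ) : {w | wordContent w = d}.Finite := by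
  by_cases h : ∃ w₀, wordContent w₀ = d
  · obtain ⟨w₀, rfl⟩ := h
    refine (List.finite_toSet w₀.permutations).subset fun w hw => ?_
    exact List.mem_permutations.2 (wordContent_eq_iff_perm.1 hw)
  · refine Set.Finite.subset Set.finite_empty fun w hw => h ⟨w, hw⟩

/-- The last entry of the row `r` exceeds the first entry of the row `r'` above it. -/
def RowDescent (r r' : List ℕ) : Prop := r'.getD 0 0 < r.getD (r.length - 1) 0

/-- The fillings of a ribbon with content `d`, given by the list of rows from bottom to top. The row
lengths, from bottom to top, are `L`. -/
def ribbonFillings (L : List ℕ) (d : ℕ →₀ ℕ) : Set (List (List ℕ)) :=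
  {R | R.map List.length = L ∧ (∀ r ∈ R, r.Pairwise (· ≤ ·)) ∧ R.IsChain RowDescent ∧
    wordContent R.flatten = d}

/-- The generating function of the fillings of a ribbon with row lengths `L` from bottom to top. -/
noncomputable def ribbonSeries (L : List ℕ) : MvPowerSeries ℕ ℤ :=
  fun d => ((ribbonFillings L d).ncard : ℤ)

theorem coeff_ribbonSeries (L : List ℕ) (d : ℕ →₀ ℕ) :
    coeff d (ribbonSeries L) = ((ribbonFillings L d).ncard : ℤ) := rfl

/-- The weakly increasing words of length `b` and content `d`. -/
def rowFillings (b : ℕ) (d : ℕ →₀ ℕ) : Set (List ℕ) :=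
  {r | r.length = b ∧ r.Pairwise (· ≤ ·) ∧ wordContent r = d}

theorem ncard_rowFillings (b : ℕ) (d : ℕ →₀ ℕ) :
    (rowFillings b d).ncard = if d.degree = b then 1 else 0 := by
  split_ifs with h
  · have hs : wordContent ((Finsupp.toMultiset d).sort (· ≤ ·)) = d := by
      rw [wordContent_eq_toFinsupp, Multiset.sort_eq, Finsupp.toMultiset_toFinsupp]
    rw [Set.ncard_eq_one]
    refine ⟨(Finsupp.toMultiset d).sort (· ≤ ·), ?_⟩
    ext r
    simp only [rowFillings, Set.mem_ofPred_eq, Set.mem_singleton_iff]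
    constructor
    · rintro ⟨_, h2, h3⟩
      refine List.Perm.eq_of_pairwise (fun a b _ _ => le_antisymm) h2
        (Multiset.pairwise_sort _ _) ?_
      rw [← wordContent_eq_iff_perm, h3, hs]
    · rintro rfl
      refine ⟨?_, Multiset.pairwise_sort _ _, hs⟩
      rw [← degree_wordContent, hs, h]
  · have : rowFillings b d = ∅ := by
      ext r
      simp only [rowFillings, Set.mem_ofPred_eq, Set.mem_empty_iff_false, iff_false]
      rintro ⟨h1, _, rfl⟩
      exact h (by rw [degree_wordContent, h1])
    rw [this, Set.ncard_empty]

/-- Pairs of a weakly increasing word of length `b` and a ribbon filling. -/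
def rowRibbonPairs (b : ℕ) (L : List ℕ) (d : ℕ →₀ ℕ) : Set (List ℕ × List (List ℕ)) :=
  {q | q.1 ∈ rowFillings b (wordContent q.1) ∧ q.2 ∈ ribbonFillings L (wordContent q.2.flatten) ∧
    wordContent q.1 + wordContent q.2.flatten = d}

/-- All row lengths are prescribed, so a pair can be read off from its concatenated word, and only
finitely many words have a given content. -/
theorem finite_rowRibbonPairs (b : ℕ) (L : List ℕ) (d : ℕ →₀ ℕ) :
    (rowRibbonPairs b L d).Finite := by
  refine Set.Finite.of_injOn (f := fun q => (q.1 ++ q.2.flatten)) (t := {w | wordContent w = d})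
    ?_ ?_ (finite_wordContent d)
  · rintro ⟨r, R⟩ ⟨_, _, h⟩
    change wordContent _ = d
    rw [wordContent_append, h]
  · rintro ⟨r, R⟩ ⟨h1, h2, -⟩ ⟨r', R'⟩ ⟨h1', h2', -⟩ h
    have h3 := List.append_inj h (h1.1.trans h1'.1.symm)
    obtain rfl : r = r' := h3.1
    obtain rfl : R = R' := List.eq_iff_flatten_eq.2 ⟨h3.2, h2.1.trans h2'.1.symm⟩
    rfl

theorem ncard_rowRibbonPairs (b : ℕ) (L : List ℕ) (d : ℕ →₀ ℕ) :
    ((rowRibbonPairs b L d).ncard : ℤ) = coeff d (ribbonSeries L * hcomplete b) := by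
  classical
  rw [coeff_mul, Set.ncard_eq_toFinset_card _ (finite_rowRibbonPairs b L d),
    Finset.card_eq_sum_card_fiberwise
      (f := fun q : List ℕ × List (List ℕ) => (wordContent q.2.flatten, wordContent q.1))
      (t := Finset.HasAntidiagonal.antidiagonal d), Nat.cast_sum]
  · refine Finset.sum_congr rfl ?_
    rintro ⟨d1, d2⟩ hd
    rw [Finset.HasAntidiagonal.mem_antidiagonal] at hd
    rw [coeff_hcomplete, coeff_ribbonSeries]
    have h1 : (if d2.degree = b then (1 : ℤ) else 0) = ((rowFillings b d2).ncard : ℤ) := by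
      rw [ncard_rowFillings]
      split_ifs <;> rfl
    rw [h1, ← Nat.cast_mul, mul_comm, ← Set.ncard_prod, ← Set.ncard_coe_finset]
    congr 2
    ext ⟨r, R⟩
    simp only [Finset.coe_filter, Set.Finite.mem_toFinset, Set.mem_ofPred_eq, Set.mem_prod,
      Prod.mk.injEq, rowRibbonPairs]
    constructor
    · rintro ⟨⟨g1, g2, -⟩, rfl, rfl⟩
      exact ⟨g1, g2⟩
    · rintro ⟨h1, h2⟩
      have e1 : wordContent r = d2 := h1.2.2
      have e2 : wordContent R.flatten = d1 := h2.2.2.2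
      subst e1 e2
      exact ⟨⟨h1, h2, by rw [add_comm]; exact hd⟩, rfl, rfl⟩
  · rintro ⟨r, R⟩ h
    simp only [Set.Finite.coe_toFinset, rowRibbonPairs, Set.mem_ofPred_eq, Finset.mem_coe,
      Finset.HasAntidiagonal.mem_antidiagonal] at h ⊢
    rw [add_comm]
    exact h.2.2

/-- For sorted words only the junction matters: the absence of a descent is exactly what allows the
two rows to merge into one. -/
theorem pairwise_append_iff {u v : List ℕ} (hu : u ≠ []) (hv : v ≠ []) :
    (u ++ v).Pairwise (· ≤ ·) ↔ u.Pairwise (· ≤ ·) ∧ v.Pairwise (· ≤ ·) ∧ ¬ RowDescent u v := by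
  have hu' := List.length_pos_iff.2 hu
  have hv' := List.length_pos_iff.2 hv
  rw [List.pairwise_append, RowDescent, not_lt, List.getD_eq_getElem _ _ hv',
    List.getD_eq_getElem _ _ (by omega)]
  refine and_congr_right fun h1 => and_congr_right fun h2 => ⟨fun h => ?_, fun h => ?_⟩
  · exact h _ (List.getElem_mem _) _ (List.getElem_mem _)
  · intro a ha b hb
    obtain ⟨i, hi, rfl⟩ := List.getElem_of_mem ha
    obtain ⟨j, hj, rfl⟩ := List.getElem_of_mem hb
    have h3 : u[i] ≤ u[u.length - 1] := by
      rcases (show i ≤ u.length - 1 by omega).eq_or_lt with h | h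
      · simp [h]
      · exact List.pairwise_iff_getElem.1 h1 _ _ _ _ h
    have h4 : v[0] ≤ v[j] := by
      rcases (Nat.zero_le j).eq_or_lt with h | h
      · simp [← h]
      · exact List.pairwise_iff_getElem.1 h2 _ _ _ _ h
    exact h3.trans (h.trans h4)

theorem rowDescent_append_iff {u v : List ℕ} (hv : v ≠ []) (r : List ℕ) :
    RowDescent (u ++ v) r ↔ RowDescent v r := by
  have hv' := List.length_pos_iff.2 hv
  unfold RowDescent
  rw [List.getD_append_right _ _ _ _ (by rw [List.length_append]; omega), List.length_append,
    show u.length + v.length - 1 - u.length = v.length - 1 by omega]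

theorem isChain_merge_iff {u v : List ℕ} (hv : v ≠ []) (R : List (List ℕ)) :
    ((u ++ v) :: R).IsChain RowDescent ↔ (v :: R).IsChain RowDescent := by
  cases R with
  | nil => simp
  | cons r R => rw [List.isChain_cons_cons, List.isChain_cons_cons, rowDescent_append_iff hv]

/-- Place a row of length b below the ribbon. If there is a descent to the old bottom row, the
result is a filling of the ribbon with one more row; otherwise the two rows concatenate to a single
row of length b + a, which can be cut again after b entries. -/
theorem ribbonSeries_mul_hcomplete {a b : ℕ} (ha : 0 < a) (hb : 0 < b) (L : List ℕ) :
    ribbonSeries (a :: L) * hcomplete b =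
      ribbonSeries (b :: a :: L) + ribbonSeries ((b + a) :: L) := by
  ext d
  rw [← ncard_rowRibbonPairs, map_add, coeff_ribbonSeries, coeff_ribbonSeries, ← Nat.cast_add,
    ← Set.ncard_inter_add_ncard_sdiff_eq_ncard _ {q | RowDescent q.1 (q.2.headD [])}
      (finite_rowRibbonPairs _ _ _)]
  congr 2
  · refine Set.ncard_congr (fun q _ => q.1 :: q.2) ?_ ?_ ?_
    · rintro ⟨r, R⟩ ⟨⟨⟨h1, h2, -⟩, ⟨h4, h5, h6, -⟩, h8⟩, h9⟩
      cases R with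
      | nil => simp at h4
      | cons r' R =>
        refine ⟨by simpa [h1] using h4, by simpa [h2] using h5,
          List.isChain_cons_cons.2 ⟨h9, h6⟩, ?_⟩
        rw [List.flatten_cons, wordContent_append]
        exact h8
    · rintro ⟨r, R⟩ ⟨r', R'⟩ - - h
      obtain ⟨rfl, rfl⟩ := List.cons_eq_cons.1 h
      rfl
    · rintro R ⟨h1, h2, h3, h4⟩
      rcases R with _ | ⟨r, _ | ⟨r', R⟩⟩
      · simp at h1
      · simp at h1
      · rw [List.isChain_cons_cons] at h3
        rw [List.flatten_cons, wordContent_append] at h4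
        rw [List.map_cons, List.cons_eq_cons] at h1
        rw [List.forall_mem_cons] at h2
        exact ⟨(r, r' :: R), ⟨⟨⟨h1.1, h2.1, rfl⟩, ⟨h1.2, h2.2, h3.2, rfl⟩, h4⟩, h3.1⟩, rfl⟩
  · refine Set.ncard_congr (fun q _ => (q.1 ++ q.2.headD []) :: q.2.tail) ?_ ?_ ?_
    · rintro ⟨r, R⟩ ⟨⟨⟨h1, h2, -⟩, ⟨h4, h5, h6, -⟩, h8⟩, h9⟩
      cases R with
      | nil => simp at h4
      | cons r' R =>
        simp only [List.headD_cons, List.tail_cons] at h1 h2 h5 h8 h9 ⊢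
        rw [List.map_cons, List.cons_eq_cons] at h4
        rw [List.forall_mem_cons] at h5
        have n1 : r ≠ [] := List.length_pos_iff.1 (by omega)
        have n2 : r' ≠ [] := List.length_pos_iff.1 (by omega)
        refine ⟨by simp [h1, h4.1, h4.2], ?_, (isChain_merge_iff n2 R).2 h6, ?_⟩
        · rw [List.forall_mem_cons]
          exact ⟨(pairwise_append_iff n1 n2).2 ⟨h2, h5.1, h9⟩, h5.2⟩
        · rw [List.flatten_cons, List.append_assoc, wordContent_append, ← List.flatten_cons]
          exact h8
    · rintro ⟨r, R⟩ ⟨r', R'⟩ ⟨⟨⟨h1, -, -⟩, ⟨h4, -, -, -⟩, -⟩, -⟩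
        ⟨⟨⟨h1', -, -⟩, ⟨h4', -, -, -⟩, -⟩, -⟩ h
      cases R with
      | nil => simp at h4
      | cons s R =>
        cases R' with
        | nil => simp at h4'
        | cons s' R' =>
          simp only [List.headD_cons, List.tail_cons, List.cons_eq_cons] at h h1 h1'
          obtain ⟨h, rfl⟩ := h
          obtain ⟨rfl, rfl⟩ := List.append_inj h (h1.trans h1'.symm)
          rfl
    · rintro R ⟨h1, h2, h3, h4⟩
      cases R with
      | nil => simp at h1
      | cons s R =>
        rw [List.map_cons, List.cons_eq_cons] at h1
        rw [List.forall_mem_cons] at h2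
        obtain ⟨u, v, rfl, hu, hv⟩ : ∃ u v, s = u ++ v ∧ u.length = b ∧ v.length = a :=
          ⟨s.take b, s.drop b, (List.take_append_drop b s).symm, by simp; omega, by simp; omega⟩
        have n1 : u ≠ [] := List.length_pos_iff.1 (by omega)
        have n2 : v ≠ [] := List.length_pos_iff.1 (by omega)
        rw [pairwise_append_iff n1 n2] at h2
        rw [isChain_merge_iff n2] at h3
        rw [List.flatten_cons, List.append_assoc, wordContent_append, ← List.flatten_cons] at h4
        refine ⟨(u, v :: R), ⟨⟨⟨hu, h2.1.1, rfl⟩, ⟨?_, ?_, h3, rfl⟩, h4⟩, h2.1.2.2⟩, rfl⟩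
        · simp [hv, h1.2]
        · rw [List.forall_mem_cons]
          exact ⟨h2.1.2.1, h2.2⟩

theorem ribbonSeries_singleton (a : ℕ) : ribbonSeries [a] = hcomplete a := by
  ext d
  rw [coeff_ribbonSeries, coeff_hcomplete]
  have h : (ribbonFillings [a] d).ncard = (rowFillings a d).ncard := by
    refine Set.ncard_congr (fun R _ => R.headD []) ?_ ?_ ?_
    · rintro R ⟨h1, h2, -, h4⟩
      rcases R with _ | ⟨r, _ | ⟨r', R⟩⟩
      · simp at h1
      · exact ⟨by simpa using h1, by simpa using h2, by simpa using h4⟩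
      · simp at h1
    · rintro R R' ⟨h1, -⟩ ⟨h1', -⟩ h
      rcases R with _ | ⟨r, _ | ⟨r', R⟩⟩ <;> rcases R' with _ | ⟨s, _ | ⟨s', R'⟩⟩ <;> simp_all
    · rintro r ⟨h1, h2, h3⟩
      exact ⟨[r], ⟨by simp [h1], by simpa using h2, by simp, by simpa using h3⟩, rfl⟩
  rw [h, ncard_rowFillings]
  split_ifs <;> rfl

/-! ### Tableaux of ribbon shape as ribbon fillings -/

namespace Ribbon

variable {m : ℕ}

/-- The row lengths of a ribbon from bottom to top. -/
def rowLensUp (α : Ribbon m) : List ℕ := (List.ofFn α.rowLen).reverse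

/-- The rows of a tableau of ribbon shape from bottom to top. -/
def rows (α : Ribbon m) (T : SkewTableau α.outer α.inner) : List (List ℕ) :=
  (List.ofFn fun i : Fin m =>
    List.ofFn fun c : Fin (α.rowLen i) => T.entry i (α.shift i + c)).reverse

theorem sum_cells {M : Type*} [AddCommMonoid M] (α : Ribbon m) (f : ℕ × ℕ → M) :
    ∑ b ∈ α.outer.cells \ α.inner.cells, f b =
      ∑ i : Fin m, ∑ c : Fin (α.rowLen i), f (i, α.shift i + c) := by
  rw [Finset.sum_sigma']
  symm
  refine Finset.sum_bij (fun x _ => ((x.1 : ℕ), α.shift x.1 + x.2)) ?_ ?_ ?_ fun _ _ => rfl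
  · rintro ⟨i, c⟩ -
    rw [mem_cells]
    exact ⟨i.2, by simp, by simp⟩
  · rintro ⟨i, c⟩ - ⟨i', c'⟩ - h
    simp only [Prod.mk.injEq, Fin.val_inj] at h
    obtain ⟨rfl, h⟩ := h
    simp only [Nat.add_left_cancel_iff, Fin.val_inj] at h
    rw [h]
  · rintro ⟨r, c⟩ h
    rw [mem_cells] at h
    obtain ⟨h, h1, h2⟩ := h
    refine ⟨⟨⟨r, h⟩, ⟨c - α.shift ⟨r, h⟩, by omega⟩⟩,
      Finset.mem_sigma.2 ⟨Finset.mem_univ _, Finset.mem_univ _⟩, ?_⟩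
    simp only [Prod.mk.injEq, true_and]
    omega

theorem wordContent_rows (α : Ribbon m) (T : SkewTableau α.outer α.inner) :
    wordContent (α.rows T).flatten = T.content := by
  rw [SkewTableau.content, sum_cells α fun b => Finsupp.single (T.entry b.1 b.2) 1]
  rw [wordContent, List.map_flatten, List.sum_flatten, rows, List.map_reverse, List.map_reverse,
    List.sum_reverse, List.map_ofFn, List.map_ofFn, List.sum_ofFn]
  refine Finset.sum_congr rfl fun i _ => ?_
  simp [List.map_ofFn, List.sum_ofFn]

/-- Since every row has at least two boxes, a row ends strictly to the left of the row two places
above it. So the column condition of a ribbon tableau concerns only the single overlap of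
consecutive rows, where it is `RowDescent`. -/
theorem eq_succ_of_same_column (α : Ribbon m) {i i' : Fin m} {c : ℕ} (h : i < i')
    (h1 : α.shift i ≤ c) (h2 : c < α.shift i' + α.rowLen i') :
    i.val + 1 = i'.val ∧ c = α.shift i := by
  have hi : i.val < i'.val := h
  have h3 := α.shift_eq i ⟨i.val + 1, by omega⟩ rfl
  have h4 := α.shift_add_rowLen_antitone (a := ⟨i.val + 1, by omega⟩) (b := i')
    (by rw [Fin.le_def]; exact hi)
  simp only at h4
  refine ⟨?_, by omega⟩
  by_contra hne
  have h5 := α.shift_eq ⟨i.val + 1, by omega⟩ ⟨i.val + 2, by omega⟩ rfl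
  have h6 := α.shift_add_rowLen_antitone (a := ⟨i.val + 2, by omega⟩) (b := i')
    (by rw [Fin.le_def]; simp only; omega)
  have h7 := α.two_le ⟨i.val + 1, by omega⟩
  simp only at h6
  omega

theorem rows_mem (α : Ribbon m) (T : SkewTableau α.outer α.inner) :
    α.rows T ∈ ribbonFillings α.rowLensUp T.content := by
  refine ⟨?_, ?_, ?_, α.wordContent_rows T⟩
  · rw [rows, rowLensUp, List.map_reverse, List.map_ofFn]
    congr 2
    ext i
    simp
  · intro r hr
    rw [rows, List.mem_reverse, List.mem_ofFn] at hr
    obtain ⟨i, rfl⟩ := hr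
    rw [List.pairwise_ofFn]
    intro c c' h
    refine T.row_weak (by simpa using h) ?_ ?_
    · rw [mem_cells]
      exact ⟨i.2, by simp, by simp⟩
    · rw [mem_cells]
      exact ⟨i.2, by simp, by simp⟩
  · rw [rows, List.isChain_reverse, List.isChain_ofFn]
    intro i hi
    have h1 := α.two_le ⟨i, by omega⟩
    have h2 := α.two_le ⟨i + 1, hi⟩
    have h3 := α.shift_eq ⟨i, by omega⟩ ⟨i + 1, hi⟩ rfl
    rw [RowDescent, List.getD_eq_getElem _ _ (by simp; omega),
      List.getD_eq_getElem _ _ (by simp; omega)]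
    simp only [List.getElem_ofFn, List.length_ofFn, add_zero]
    rw [show α.shift ⟨i + 1, hi⟩ + (α.rowLen ⟨i + 1, hi⟩ - 1) = α.shift ⟨i, by omega⟩ by omega]
    refine T.col_strict (Nat.lt_add_one i) ?_ ?_
    · rw [mem_cells]
      exact ⟨by omega, by omega, by omega⟩
    · rw [mem_cells]
      exact ⟨by omega, by omega, by omega⟩

theorem rows_injective (α : Ribbon m) : Function.Injective α.rows := by
  intro T T' h
  rw [rows, rows, List.reverse_inj, List.ofFn_inj] at h
  ext i c
  by_cases hc : (i, c) ∈ α.outer.cells \ α.inner.cells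
  · obtain ⟨hi, h1, h2⟩ := (α.mem_cells i c).1 hc
    have h3 := congrFun (List.ofFn_injective (congrFun h ⟨i, hi⟩))
      ⟨c - α.shift ⟨i, hi⟩, by omega⟩
    simp only at h3
    rwa [show α.shift ⟨i, hi⟩ + (c - α.shift ⟨i, hi⟩) = c by omega] at h3
  · rw [T.zeros hc, T'.zeros hc]

theorem exists_rows_eq (α : Ribbon m) {R : List (List ℕ)} {d : ℕ →₀ ℕ}
    (hR : R ∈ ribbonFillings α.rowLensUp d) : ∃ T, α.rows T = R := by
  obtain ⟨h1, h2, h3, -⟩ := hR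
  obtain ⟨S, rfl⟩ : ∃ S : List (List ℕ), R = S.reverse := ⟨R.reverse, by simp⟩
  rw [rowLensUp, List.map_reverse, List.reverse_inj] at h1
  simp only [List.mem_reverse] at h2
  rw [List.isChain_reverse] at h3
  have hm : S.length = m := by simpa using congrArg List.length h1
  obtain ⟨f, rfl⟩ : ∃ f : Fin m → List ℕ, S = List.ofFn f := by
    subst hm
    exact ⟨S.get, (List.ofFn_get S).symm⟩
  rw [List.map_ofFn, List.ofFn_inj] at h1
  have hlen : ∀ i, (f i).length = α.rowLen i := fun i => congrFun h1 i
  rw [List.isChain_ofFn] at h3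
  have hmono : ∀ (i : Fin m) (c c' : ℕ), c ≤ c' → c' < α.rowLen i →
      (f i).getD c 0 ≤ (f i).getD c' 0 := by
    intro i c c' h h'
    rcases h.eq_or_lt with rfl | h
    · exact le_rfl
    rw [List.getD_eq_getElem _ _ (by rw [hlen]; omega),
      List.getD_eq_getElem _ _ (by rw [hlen]; omega)]
    exact List.pairwise_iff_getElem.1 (h2 _ (List.mem_ofFn.2 ⟨i, rfl⟩)) _ _ _ _ h
  classical
  let e : ℕ → ℕ → ℕ := fun r c =>
    if h : (r, c) ∈ α.outer.cells \ α.inner.cells then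
      (f ⟨r, ((α.mem_cells r c).1 h).1⟩).getD
        (c - α.shift ⟨r, ((α.mem_cells r c).1 h).1⟩) 0 else 0
  have he : ∀ (i : Fin m) (c : ℕ), c < α.rowLen i →
      e i (α.shift i + c) = (f i).getD c 0 := by
    intro i c hc
    have hmem : ((i : ℕ), α.shift i + c) ∈ α.outer.cells \ α.inner.cells := by
      rw [mem_cells]
      exact ⟨i.2, by simp, by simpa using hc⟩
    simp only [e]
    rw [dif_pos hmem]
    simp
  refine ⟨⟨e, ?_, ?_, ?_⟩, ?_⟩
  · intro r c c' h hc hc'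
    obtain ⟨hr, a1, a2⟩ := (α.mem_cells r c).1 hc
    obtain ⟨_, b1, b2⟩ := (α.mem_cells r c').1 hc'
    simp only [e]
    rw [dif_pos hc, dif_pos hc']
    exact hmono _ _ _ (by omega) (by omega)
  · intro r r' c h hc hc'
    obtain ⟨hr, a1, a2⟩ := (α.mem_cells r c).1 hc
    obtain ⟨hr', b1, b2⟩ := (α.mem_cells r' c).1 hc'
    have h4 := α.eq_succ_of_same_column (i := ⟨r, hr⟩) (i' := ⟨r', hr'⟩) h a1 b2
    obtain ⟨h4, h5⟩ := h4
    simp only at h4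
    subst h4
    have h6 := α.shift_eq ⟨r, hr⟩ ⟨r + 1, hr'⟩ rfl
    have h7 := h3 r hr'
    rw [RowDescent, hlen] at h7
    simp only [e]
    rw [dif_pos hc, dif_pos hc', show c - α.shift ⟨r, hr⟩ = 0 by omega,
      show c - α.shift ⟨r + 1, hr'⟩ = α.rowLen ⟨r + 1, hr'⟩ - 1 by omega]
    exact h7
  · intro r c h
    simp only [e]
    rw [dif_neg h]
  · rw [rows, List.reverse_inj, List.ofFn_inj]
    ext1 i
    refine List.ext_getElem (by simp [hlen]) fun c hc _ => ?_
    rw [List.length_ofFn] at hc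
    rw [List.getElem_ofFn]
    simp only
    rw [he i c hc, List.getD_eq_getElem]

theorem skewSchur_eq_ribbonSeries (α : Ribbon m) :
    skewSchur α.outer α.inner = ribbonSeries α.rowLensUp := by
  ext d
  rw [coeff_ribbonSeries]
  change ((Nat.card {T : SkewTableau α.outer α.inner // T.content = d} : ℕ) : ℤ) = _
  congr 1
  refine Nat.card_eq_of_bijective (fun T => (⟨α.rows T.1, by
    have := α.rows_mem T.1
    rwa [T.2] at this⟩ : ribbonFillings α.rowLensUp d)) ⟨?_, ?_⟩
  · intro T T' h
    exact Subtype.ext (α.rows_injective (congrArg Subtype.val h))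
  · rintro ⟨R, hR⟩
    obtain ⟨T, rfl⟩ := α.exists_rows_eq hR
    refine ⟨⟨T, ?_⟩, rfl⟩
    rw [← α.wordContent_rows T]
    exact hR.2.2.2

end Ribbon

/-! ### Chains of horizontal strips with descents -/

namespace YoungDiagram

/-- The lowest row that meets the skew shape `mu / lam`. -/
def stripBot (lam mu : YoungDiagram) : ℕ :=
  Nat.findGreatest (fun i => lam.rowLen i < mu.rowLen i) mu.card

theorem stripBot_eq {lam mu : YoungDiagram} {p : ℕ} (h : lam.rowLen p < mu.rowLen p)
    (h' : ∀ i, p < i → mu.rowLen i ≤ lam.rowLen i) : stripBot lam mu = p := by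
  rw [stripBot, Nat.findGreatest_eq_iff]
  refine ⟨?_, fun _ => h, fun n hn _ => not_lt.2 (h' n hn)⟩
  by_contra! hlt
  rw [rowLen_eq_zero_of_le mu.rowLen_card hlt.le] at h
  omega

theorem stripBot_spec {lam mu : YoungDiagram} (hle : lam ≤ mu) (hc : lam.card < mu.card) :
    lam.rowLen (stripBot lam mu) < mu.rowLen (stripBot lam mu) ∧
      ∀ i, stripBot lam mu < i → mu.rowLen i = lam.rowLen i := by
  obtain ⟨i, hi⟩ : ∃ i, lam.rowLen i < mu.rowLen i := by
    by_contra! h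
    exact absurd (card_mono (le_iff_rowLen.2 h)) (not_le.2 hc)
  have hb : ∀ i, lam.rowLen i < mu.rowLen i → i ≤ mu.card := by
    intro i hi
    by_contra! hlt
    rw [rowLen_eq_zero_of_le mu.rowLen_card hlt.le] at hi
    omega
  refine ⟨Nat.findGreatest_spec (P := fun i => lam.rowLen i < mu.rowLen i) (hb i hi) hi,
    fun j hj => le_antisymm ?_ (le_iff_rowLen.1 hle j)⟩
  by_contra! h
  exact absurd (Nat.le_findGreatest (P := fun i => lam.rowLen i < mu.rowLen i) (hb j h) h)
    (not_le.2 hj)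

/-- The skew shape `lam / kap` has a box above row `p`. -/
def MeetsAbove (kap lam : YoungDiagram) (p : ℕ) : Prop := ∃ i < p, kap.rowLen i < lam.rowLen i

theorem rowLen_eq_of_not_meetsAbove {kap lam : YoungDiagram} (h : kap ≤ lam) {p : ℕ}
    (hp : ¬ MeetsAbove kap lam p) {i : ℕ} (hi : i < p) : kap.rowLen i = lam.rowLen i := by
  refine le_antisymm (le_iff_rowLen.1 h i) ?_
  by_contra! hlt
  exact hp ⟨i, hi, hlt⟩

/-- A horizontal strip splits into a left part of prescribed size and a right part. -/
theorem exists_split {kap mu : YoungDiagram} (h : HStrip kap mu) {a b : ℕ} (hb : 0 < b)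
    (hc : mu.card = kap.card + (b + a)) :
    ∃ lam : YoungDiagram, mu.card = lam.card + b ∧ HStrip lam mu ∧ lam.card = kap.card + a ∧
      HStrip kap lam ∧ ¬ MeetsAbove kap lam (stripBot lam mu) := by
  set N := mu.card
  set x : ℕ → ℕ := fun i => mu.rowLen i - kap.rowLen i with hx
  set S : ℕ → ℕ := fun i => ∑ k ∈ Finset.Ico i N, x k with hS
  -- `S i` counts the strip boxes in rows i and below. The left part takes the first a boxes of the
  -- strip from the bottom row upwards: row i contributes what is left of a after the lower rows, up
  -- to its own supply.
  set f : ℕ → ℕ := fun i => kap.rowLen i + min (x i) (a - S (i + 1)) with hf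
  have hSanti : Antitone S := fun i j hij =>
    Finset.sum_le_sum_of_subset (Finset.Ico_subset_Ico_left hij)
  have hSsucc : ∀ i, i < N → S i = x i + S (i + 1) := fun i hi =>
    Finset.sum_eq_sum_Ico_succ_bot hi _
  have hmuN : mu.rowLen N = 0 := mu.rowLen_card
  have hkN : kap.rowLen N = 0 := by have := (h N).1; omega
  have hlow : ∀ i, kap.rowLen i ≤ f i := fun i => Nat.le_add_right _ _
  have hupp : ∀ i, f i ≤ mu.rowLen i := fun i => by
    have := (h i).1
    simp only [hf, hx]
    omega
  have hanti : Antitone f := antitone_nat_of_succ_le fun i =>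
    (hupp (i + 1)).trans ((h i).2.trans (hlow i))
  have hfN : f N = 0 := Nat.le_zero.1 (hmuN ▸ hupp N)
  have hsum : ∀ j, j ≤ N → ∑ k ∈ Finset.Ico (N - j) N, min (x k) (a - S (k + 1)) =
      min (S (N - j)) a := by
    intro j
    induction j with
    | zero => simp [hS]
    | succ j ih =>
      intro hj
      have h1 := ih (by omega)
      have h2 := hSsucc (N - (j + 1)) (by omega)
      rw [Finset.sum_eq_sum_Ico_succ_bot (by omega)]
      rw [show N - (j + 1) + 1 = N - j by omega] at h2 ⊢
      rw [h1]
      omega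
  have hS0 : S 0 = b + a := by
    have h1 := mu.card_eq_sum_rowLen hmuN
    have h2 := kap.card_eq_sum_rowLen hkN
    have h3 : ∑ k ∈ Finset.range N, mu.rowLen k =
        ∑ k ∈ Finset.range N, kap.rowLen k + ∑ k ∈ Finset.range N, x k := by
      rw [← Finset.sum_add_distrib]
      refine Finset.sum_congr rfl fun i _ => ?_
      have := (h i).1
      simp only [hx]
      omega
    simp only [hS, ← Finset.range_eq_Ico]
    omega
  have hcard : (ofFun f hanti ⟨N, hfN⟩).card = kap.card + a := by
    have h1 := hsum N le_rfl
    rw [Nat.sub_self, hS0, ← Finset.range_eq_Ico] at h1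
    rw [card_eq_sum_rowLen (N := N) _ (by simpa using hfN), kap.card_eq_sum_rowLen hkN]
    simp only [rowLen_ofFun, hf, Finset.sum_add_distrib]
    omega
  have hst : HStrip (ofFun f hanti ⟨N, hfN⟩) mu := fun i => by
    rw [rowLen_ofFun]
    exact ⟨hupp i, (h i).2.trans (hlow i)⟩
  refine ⟨ofFun f hanti ⟨N, hfN⟩, by omega, hst, hcard, fun i => ?_, ?_⟩
  · rw [rowLen_ofFun, rowLen_ofFun]
    exact ⟨hlow i, (hupp _).trans (h i).2⟩
  · rintro ⟨i, hi, hlt⟩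
    have h1 := (stripBot_spec hst.le (by omega)).1
    set p := stripBot (ofFun f hanti ⟨N, hfN⟩) mu
    rw [rowLen_ofFun] at h1 hlt
    have hpN : p < N := by
      by_contra! hle
      rw [rowLen_eq_zero_of_le hmuN hle] at h1
      omega
    have h2 := hSsucc p hpN
    have h3 := hSanti (show i + 1 ≤ p from hi)
    simp only [hf] at h1 hlt
    have h4 := (h p).1
    have h5 : x p = mu.rowLen p - kap.rowLen p := rfl
    omega

/-- A split is a cut of the strip: below the cut row the middle diagram agrees with mu, above it
with kap. Two cuts are therefore nested according to their position, and with equal sizes they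
coincide. -/
theorem le_of_split {kap lam lam' mu : YoungDiagram} (hk : kap ≤ lam) (hk' : kap ≤ lam')
    (hm : lam ≤ mu) (hm' : lam' ≤ mu) (hc : lam.card < mu.card) (hc' : lam'.card < mu.card)
    (hle : stripBot lam mu < stripBot lam' mu ∨ stripBot lam mu = stripBot lam' mu ∧
      lam'.rowLen (stripBot lam mu) ≤ lam.rowLen (stripBot lam mu))
    (hn' : ¬ MeetsAbove kap lam' (stripBot lam' mu)) : lam' ≤ lam := by
  obtain ⟨-, h2⟩ := stripBot_spec hm hc
  obtain ⟨-, h2'⟩ := stripBot_spec hm' hc'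
  refine le_iff_rowLen.2 fun i => ?_
  rcases lt_trichotomy i (stripBot lam mu) with h | h | h
  · rw [← rowLen_eq_of_not_meetsAbove hk' hn' (i := i) (by omega)]
    exact le_iff_rowLen.1 hk i
  · subst h
    rcases hle with hlt | heq
    · rw [← rowLen_eq_of_not_meetsAbove hk' hn' hlt]
      exact le_iff_rowLen.1 hk _
    · exact heq.2
  · rw [← h2 i h]
    exact le_iff_rowLen.1 hm' i

theorem split_unique {kap lam lam' mu : YoungDiagram} (hk : kap ≤ lam) (hk' : kap ≤ lam')
    (hm : lam ≤ mu) (hm' : lam' ≤ mu) (hc : lam.card < mu.card) (hcc : lam.card = lam'.card)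
    (hn : ¬ MeetsAbove kap lam (stripBot lam mu))
    (hn' : ¬ MeetsAbove kap lam' (stripBot lam' mu)) : lam = lam' := by
  have hc' : lam'.card < mu.card := hcc ▸ hc
  rcases lt_trichotomy (stripBot lam mu) (stripBot lam' mu) with h | h | h
  · exact (eq_of_le_of_card (le_of_split hk hk' hm hm' hc hc' (Or.inl h) hn') hcc.symm).symm
  · rcases le_total (lam'.rowLen (stripBot lam mu)) (lam.rowLen (stripBot lam mu)) with g | g
    · exact (eq_of_le_of_card (le_of_split hk hk' hm hm' hc hc' (Or.inr ⟨h, g⟩) hn')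
        hcc.symm).symm
    · exact eq_of_le_of_card (le_of_split hk' hk hm' hm hc' hc (Or.inr ⟨h.symm, h ▸ g⟩) hn) hcc
  · exact eq_of_le_of_card (le_of_split hk' hk hm' hm hc' hc (Or.inl h) hn) hcc

/-- Without a descent, the lower strip starts no higher than the upper one, so merging them does not
change the lowest row. This keeps the condition on the preceding strip intact in `ribbonCoeff_add`.
-/
theorem stripBot_of_not_meetsAbove {kap lam mu : YoungDiagram} (hk : kap ≤ lam) (hm : lam ≤ mu)
    (hck : kap.card < lam.card) (hc : lam.card < mu.card)
    (hn : ¬ MeetsAbove kap lam (stripBot lam mu)) : stripBot kap lam = stripBot kap mu := by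
  obtain ⟨h1, h2⟩ := stripBot_spec hk hck
  obtain ⟨-, h3⟩ := stripBot_spec hm hc
  symm
  refine stripBot_eq (h1.trans_le (le_iff_rowLen.1 hm _)) fun i hi => ?_
  have h4 : stripBot lam mu ≤ stripBot kap lam := by
    by_contra! hlt
    exact hn ⟨_, hlt, h1⟩
  rw [h3 i (by omega), h2 i hi]

open Classical in
/-- The number of chains of horizontal strips from the empty diagram to `lam` with strip sizes `L`,
the last strip first, such that there is a descent between any two successive strips and the last
strip has a box above row `p`. -/
noncomputable def descentChains : List ℕ → YoungDiagram → ℕ → ℕ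
  | [], lam, _ => if lam = ⊥ then 1 else 0
  | a :: L, lam, p => ∑ kap ∈ (downs lam a).filter (MeetsAbove · lam p),
      descentChains L kap (stripBot kap lam)

/-- The number of standard tableaux of shape `mu` whose descent composition is the reverse of `L`,
as a number of chains of horizontal strips. -/
noncomputable def ribbonCoeff : List ℕ → YoungDiagram → ℕ
  | [], mu => descentChains [] mu 0
  | b :: L, mu => ∑ lam ∈ downs mu b, descentChains L lam (stripBot lam mu)

/-- The coefficient version of `ribbonSeries_mul_hcomplete`. On the right, no condition links the
last two strips. Pairs with a descent give the first summand; pairs without one merge into a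
horizontal strip of size b + a, which by `exists_split` and `split_unique` arises exactly once. -/
theorem ribbonCoeff_add {a b : ℕ} (ha : 0 < a) (hb : 0 < b) (L : List ℕ) (mu : YoungDiagram) :
    ribbonCoeff (b :: a :: L) mu + ribbonCoeff ((b + a) :: L) mu =
      ∑ lam ∈ downs mu b, ribbonCoeff (a :: L) lam := by
  classical
  have key : ∑ lam ∈ downs mu b,
      ∑ kap ∈ (downs lam a).filter (fun kap => ¬ MeetsAbove kap lam (stripBot lam mu)),
        descentChains L kap (stripBot kap lam) = ribbonCoeff ((b + a) :: L) mu := by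
    rw [Finset.sum_sigma', ribbonCoeff]
    refine Finset.sum_bij (fun q _ => q.2) ?_ ?_ ?_ ?_
    · rintro ⟨lam, kap⟩ h
      simp only [Finset.mem_sigma, Finset.mem_filter, mem_downs] at h ⊢
      obtain ⟨⟨h1, h2⟩, ⟨h3, h4⟩, h5⟩ := h
      refine ⟨by omega, fun i => ⟨(h4 i).1.trans (h2 i).1, ?_⟩⟩
      have h6 := (stripBot_spec h2.le (by omega)).2
      by_cases hi : i < stripBot lam mu
      · rw [rowLen_eq_of_not_meetsAbove h4.le h5 hi]
        exact (h2 i).2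
      · rw [h6 (i + 1) (by omega)]
        exact (h4 i).2
    · rintro ⟨lam, kap⟩ h ⟨lam', kap'⟩ h' rfl
      simp only [Finset.mem_sigma, Finset.mem_filter, mem_downs] at h h'
      obtain ⟨⟨h1, h2⟩, ⟨h3, h4⟩, h5⟩ := h
      obtain ⟨⟨h1', h2'⟩, ⟨h3', h4'⟩, h5'⟩ := h'
      obtain rfl := split_unique h4.le h4'.le h2.le h2'.le (by omega) (by omega) h5 h5'
      rfl
    · intro kap h
      rw [mem_downs] at h
      obtain ⟨lam, h1, h2, h3, h4, h5⟩ := exists_split h.2 hb h.1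
      refine ⟨⟨lam, kap⟩, ?_, rfl⟩
      simp only [Finset.mem_sigma, Finset.mem_filter, mem_downs]
      exact ⟨⟨h1, h2⟩, ⟨h3, h4⟩, h5⟩
    · rintro ⟨lam, kap⟩ h
      simp only [Finset.mem_sigma, Finset.mem_filter, mem_downs] at h
      obtain ⟨⟨h1, h2⟩, ⟨h3, h4⟩, h5⟩ := h
      rw [stripBot_of_not_meetsAbove h4.le h2.le (by omega) (by omega) h5]
  rw [← key, ribbonCoeff, ← Finset.sum_add_distrib]
  refine Finset.sum_congr rfl fun lam _ => ?_
  rw [ribbonCoeff, descentChains]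
  convert Finset.sum_filter_add_sum_filter_not (downs lam a)
    (fun kap => MeetsAbove kap lam (stripBot lam mu)) _

open Classical in
theorem ribbonCoeff_singleton (a : ℕ) (mu : YoungDiagram) :
    ribbonCoeff [a] mu = if mu ∈ ups ⊥ a then 1 else 0 := by
  rw [ribbonCoeff]
  simp only [descentChains]
  split_ifs with h <;> rw [← mem_downs_iff_mem_ups] at h
  · rw [Finset.sum_eq_single_of_mem _ h fun _ _ hb => if_neg hb, if_pos rfl]
  · exact Finset.sum_eq_zero fun lam hlam => if_neg (by rintro rfl; exact h hlam)

theorem descentChains_nil_ne_zero {lam : YoungDiagram} {p : ℕ} :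
    descentChains [] lam p ≠ 0 ↔ lam = ⊥ := by
  simp [descentChains]

theorem descentChains_cons_ne_zero {a : ℕ} {L : List ℕ} {lam : YoungDiagram} {p : ℕ} :
    descentChains (a :: L) lam p ≠ 0 ↔ ∃ kap ∈ downs lam a, MeetsAbove kap lam p ∧
      descentChains L kap (stripBot kap lam) ≠ 0 := by
  rw [descentChains, ne_eq, Finset.sum_eq_zero_iff]
  simp only [Finset.mem_filter, not_forall, and_imp, exists_prop]

theorem ribbonCoeff_cons_ne_zero {b : ℕ} {L : List ℕ} {mu : YoungDiagram} :
    ribbonCoeff (b :: L) mu ≠ 0 ↔ ∃ lam ∈ downs mu b,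
      descentChains L lam (stripBot lam mu) ≠ 0 := by
  rw [ribbonCoeff, ne_eq, Finset.sum_eq_zero_iff]
  simp only [not_forall, exists_prop]

theorem card_eq_of_descentChains_ne_zero {L : List ℕ} {mu : YoungDiagram} {p : ℕ}
    (h : descentChains L mu p ≠ 0) : mu.card = L.sum := by
  induction L generalizing mu p with
  | nil =>
    rw [descentChains_nil_ne_zero] at h
    rw [h]
    rfl
  | cons a L ih =>
    obtain ⟨kap, h1, -, h2⟩ := descentChains_cons_ne_zero.1 h
    rw [mem_downs] at h1
    rw [h1.1, ih h2, List.sum_cons, add_comm]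

theorem card_eq_of_ribbonCoeff_ne_zero {L : List ℕ} {mu : YoungDiagram}
    (h : ribbonCoeff L mu ≠ 0) : mu.card = L.sum := by
  cases L with
  | nil => exact card_eq_of_descentChains_ne_zero (p := 0) h
  | cons a L =>
    obtain ⟨kap, h1, h2⟩ := ribbonCoeff_cons_ne_zero.1 h
    rw [mem_downs] at h1
    rw [h1.1, card_eq_of_descentChains_ne_zero h2, List.sum_cons, add_comm]

end YoungDiagram

/-! ### Schur expansion of ribbons and linear independence -/

open YoungDiagram MvPowerSeries

/-- The Schur expansion of a ribbon Schur function. -/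
theorem ribbonSeries_eq_sum {a : ℕ} {L : List ℕ} (h : ∀ x ∈ a :: L, 0 < x) :
    ribbonSeries (a :: L) =
      ∑ mu ∈ ofCard (a :: L).sum, (ribbonCoeff (a :: L) mu : ℤ) • schur mu := by
  classical
  induction L generalizing a with
  | nil =>
    rw [ribbonSeries_singleton, ← one_mul (hcomplete a), ← schur_bot, schur_mul_hcomplete]
    simp only [ribbonCoeff_singleton, Nat.cast_ite, Nat.cast_one, Nat.cast_zero, ite_smul,
      one_smul, zero_smul]
    rw [← Finset.sum_filter]
    refine Finset.sum_congr ?_ fun _ _ => rfl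
    ext mu
    rw [Finset.mem_filter, mem_ofCard, and_iff_right_of_imp]
    intro h
    rw [(mem_ups.1 h).1, List.sum_singleton]
    exact Nat.zero_add a
  | cons b L ih =>
    simp only [List.forall_mem_cons] at h
    -- The product rule is solved for the ribbon with the most rows; the other two series have one
    -- row less and are covered by the induction hypothesis.
    have h1 := ribbonSeries_mul_hcomplete h.2.1 h.1 L
    have h2 := ih (a := b) (by simpa using h.2)
    have h3 := ih (a := a + b) (by simpa using ⟨by omega, h.2.2⟩)
    have hsum : ((a + b) :: L).sum = (a :: b :: L).sum := by simp [add_assoc]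
    rw [h2, h3, hsum, Finset.sum_mul] at h1
    rw [← sub_eq_iff_eq_add] at h1
    rw [← h1, sub_eq_iff_eq_add, ← Finset.sum_add_distrib]
    simp only [smul_mul_assoc, schur_mul_hcomplete, ← add_smul, ← Nat.cast_add,
      ribbonCoeff_add h.2.1 h.1, Nat.cast_sum, Finset.smul_sum, Finset.sum_smul]
    refine Finset.sum_comm' fun lam mu => ?_
    rw [mem_ofCard, mem_ofCard, mem_downs_iff_mem_ups, mem_ups, List.sum_cons (a := a)]
    constructor
    · rintro ⟨h1, h2, h3⟩
      exact ⟨⟨h2, h3⟩, by omega⟩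
    · rintro ⟨⟨h1, h2⟩, h3⟩
      exact ⟨by omega, h1, h2⟩

theorem le_entry {mu : YoungDiagram} (T : SkewTableau mu ⊥) {i j : ℕ} (h : (i, j) ∈ mu) :
    i ≤ T.entry i j := by
  induction i with
  | zero => exact Nat.zero_le _
  | succ i ih =>
    have h1 : (i, j) ∈ mu := mu.up_left_mem (Nat.le_succ i) le_rfl h
    have h2 := T.col_strict (Nat.lt_add_one i) (mem_cells_sdiff_bot.2 h1)
      (mem_cells_sdiff_bot.2 h)
    have h3 := ih h1
    omega

/-- The content of a partition. -/
noncomputable def shapeContent (mu : YoungDiagram) : ℕ →₀ ℕ :=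
  Finsupp.onFinset (Finset.range mu.card) mu.rowLen fun i hi => by
    rw [Finset.mem_range]
    by_contra! h
    exact hi (rowLen_eq_zero_of_le mu.rowLen_card h)

@[simp]
theorem shapeContent_apply (mu : YoungDiagram) (i : ℕ) : shapeContent mu i = mu.rowLen i := rfl

/-- The number of boxes in the first `k` rows. -/
def rowSum (mu : YoungDiagram) (k : ℕ) : ℕ := ∑ i ∈ Finset.range k, mu.rowLen i

theorem rowSum_eq_card (mu : YoungDiagram) (k : ℕ) :
    rowSum mu k = (mu.cells.filter fun c => c.1 < k).card := by
  have : mu.cells.filter (fun c => c.1 < k) = (Finset.range k).biUnion mu.row := by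
    ext ⟨i, j⟩
    simp [mem_row_iff, and_comm]
  rw [this, Finset.card_biUnion]
  · simp [rowLen_eq_card, rowSum]
  · intro a _ b _ hab
    rw [Function.onFun, Finset.disjoint_left]
    rintro ⟨i, j⟩ h1 h2
    rw [mem_row_iff] at h1 h2
    exact hab (h1.2.symm.trans h2.2)

theorem SkewTableau.content_apply {mu : YoungDiagram} (T : SkewTableau mu ⊥) (v : ℕ) :
    T.content v = (mu.cells.filter fun c => T.entry c.1 c.2 = v).card := by
  rw [T.content_bot, Finsupp.finsetSum_apply, Finset.card_filter]
  refine Finset.sum_congr rfl fun c _ => ?_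
  rw [Finsupp.single_apply]

/-- Entries smaller than k lie in the first k rows, because columns increase strictly. Hence the
shape dominates the content. -/
theorem rowSum_le_of_coeff_ne_zero {mu nu : YoungDiagram}
    (h : coeff (shapeContent nu) (schur mu) ≠ 0) : rowSum nu ≤ rowSum mu := by
  change ((Nat.card {T : SkewTableau mu ⊥ // T.content = shapeContent nu} : ℕ) : ℤ) ≠ 0 at h
  rw [Nat.cast_ne_zero, Nat.card_ne_zero] at h
  obtain ⟨⟨T, hT⟩⟩ := h.1
  intro k
  rw [rowSum_eq_card mu]
  calc rowSum nu k = ∑ v ∈ Finset.range k, (mu.cells.filter fun c => T.entry c.1 c.2 = v).card := by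
        refine Finset.sum_congr rfl fun v _ => ?_
        rw [← T.content_apply, hT, shapeContent_apply]
    _ = (mu.cells.filter fun c => T.entry c.1 c.2 < k).card := by
        rw [Finset.card_eq_sum_card_fiberwise (f := fun c => T.entry c.1 c.2)
          (t := Finset.range k)]
        · refine Finset.sum_congr rfl fun v hv => ?_
          rw [Finset.filter_filter]
          congr 1
          refine Finset.filter_congr fun c _ => ?_
          rw [Finset.mem_range] at hv
          omega
        · intro c hc
          simpa using (Finset.mem_filter.1 hc).2
    _ ≤ _ := by
        refine Finset.card_le_card fun c hc => ?_
        rw [Finset.mem_filter] at hc ⊢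
        exact ⟨hc.1, (le_entry T ((mem_cells _).1 hc.1)).trans_lt hc.2⟩

theorem rowSum_injective : Function.Injective rowSum := by
  intro mu nu h
  refine ext_rowLen fun i => ?_
  have h1 := congrFun h i
  have h2 := congrFun h (i + 1)
  rw [rowSum, rowSum, Finset.sum_range_succ, Finset.sum_range_succ] at h2
  rw [rowSum, rowSum] at h1
  omega

theorem coeff_shapeContent_schur_ne_zero (mu : YoungDiagram) :
    coeff (shapeContent mu) (schur mu) ≠ 0 := by
  change ((Nat.card {T : SkewTableau mu ⊥ // T.content = shapeContent mu} : ℕ) : ℤ) ≠ 0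
  rw [Nat.cast_ne_zero, Nat.card_ne_zero]
  refine ⟨⟨(SkewTableau.equivStraight mu).symm (SemistandardYoungTableau.highestWeight mu), ?_⟩,
    SkewTableau.finite_content _ _ _⟩
  ext v
  rw [SkewTableau.content_apply, shapeContent_apply, rowLen_eq_card]
  congr 1
  ext ⟨i, j⟩
  rw [mem_row_iff, Finset.mem_filter, mem_cells]
  refine and_congr_right fun h => ?_
  change (if (i, j) ∈ mu then i else 0) = v ↔ i = v
  rw [if_pos h]

/-- The Schur functions are linearly independent. -/
theorem linearIndependent_schur : LinearIndependent ℤ schur := by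
  rw [linearIndependent_iff]
  intro c hc
  by_contra hne
  -- For a dominance-maximal `mu` in the support, no other Schur function of the relation contains
  -- the monomial with exponents `mu`.
  obtain ⟨mu, hmu, hmax⟩ := Finset.exists_maximalFor rowSum c.support
    (Finsupp.support_nonempty_iff.2 hne)
  have h := congrArg (coeff (shapeContent mu)) hc
  rw [Finsupp.linearCombination_apply, Finsupp.sum, map_sum, map_zero,
    Finset.sum_eq_single_of_mem mu hmu] at h
  · rw [map_smul, smul_eq_mul, mul_eq_zero] at h
    exact h.elim (Finsupp.mem_support_iff.1 hmu) (coeff_shapeContent_schur_ne_zero mu)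
  · intro nu hnu hne'
    rw [map_smul, smul_eq_mul]
    by_contra h0
    have h1 := rowSum_le_of_coeff_ne_zero (right_ne_zero_of_mul h0)
    exact hne' (rowSum_injective (le_antisymm (hmax hnu h1) h1))

/-- The support is defined through some expansion; linear independence shows that it is the one
given by `ribbonCoeff`. -/
theorem Ribbon.mem_support_iff {m : ℕ} (hm : 0 < m) (α : Ribbon m) (nu : YoungDiagram) :
    nu ∈ α.support ↔ ribbonCoeff α.rowLensUp nu ≠ 0 := by
  classical
  have hpos : ∀ x ∈ α.rowLensUp, 0 < x := by
    intro x hx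
    rw [rowLensUp, List.mem_reverse, List.mem_ofFn] at hx
    obtain ⟨i, rfl⟩ := hx
    have := α.two_le i
    omega
  have hne : α.rowLensUp ≠ [] := by
    rw [← List.length_pos_iff]
    simpa [rowLensUp] using hm
  have hexp : skewSchur α.outer α.inner = ∑ mu ∈ ofCard α.rowLensUp.sum,
      (ribbonCoeff α.rowLensUp mu : ℤ) • schur mu := by
    rw [α.skewSchur_eq_ribbonSeries]
    revert hpos hne
    generalize α.rowLensUp = L
    intro hpos hne
    cases L with
    | nil => exact absurd rfl hne
    | cons a L => exact ribbonSeries_eq_sum hpos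
  let c₀ : YoungDiagram →₀ ℤ := Finsupp.onFinset (ofCard α.rowLensUp.sum)
    (fun mu => (ribbonCoeff α.rowLensUp mu : ℤ)) fun mu h => by
      rw [mem_ofCard]
      exact card_eq_of_ribbonCoeff_ne_zero (by exact_mod_cast h)
  have hc₀ : IsSchurExpansion α.outer α.inner c₀ := by
    rw [IsSchurExpansion, hexp, Finsupp.onFinset_sum]
    intro mu
    exact zero_smul _ _
  have huniq : ∀ c, IsSchurExpansion α.outer α.inner c → c = c₀ := by
    intro c hc
    refine linearIndependent_schur ?_
    rw [Finsupp.linearCombination_apply, Finsupp.linearCombination_apply]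
    exact hc.symm.trans hc₀
  constructor
  · rintro ⟨c, hc, hpos⟩
    rw [huniq c hc] at hpos
    change (0 : ℤ) < (ribbonCoeff α.rowLensUp nu : ℤ) at hpos
    omega
  · intro h
    refine ⟨c₀, hc₀, ?_⟩
    change (0 : ℤ) < (ribbonCoeff α.rowLensUp nu : ℤ)
    omega

/-! ### Upper bound for the last row of a shape in the support -/

namespace YoungDiagram

/-- The list `a (t - 1), …, a 1, a 0`. -/
def stripSizes (a : ℕ → ℕ) : ℕ → List ℕ
  | 0 => []
  | t + 1 => a t :: stripSizes a t

theorem length_stripSizes (a : ℕ → ℕ) (t : ℕ) : (stripSizes a t).length = t := by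
  induction t with
  | zero => rfl
  | succ t ih => rw [stripSizes, List.length_cons, ih]

theorem reverse_ofFn_eq_stripSizes {m : ℕ} (f : Fin m → ℕ) (a : ℕ → ℕ)
    (h : ∀ i : Fin m, f i = a i) : (List.ofFn f).reverse = stripSizes a m := by
  induction m with
  | zero => rfl
  | succ m ih =>
    rw [List.ofFn_succ', List.concat_eq_append, List.reverse_append, stripSizes,
      ← ih (fun i => f i.castSucc) fun i => h _]
    simp [h]

/-- A horizontal strip opens at most one new row. -/
theorem rowLen_eq_zero_of_descentChains_ne_zero {L : List ℕ} {lam : YoungDiagram} {p : ℕ}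
    (h : descentChains L lam p ≠ 0) : lam.rowLen L.length = 0 := by
  induction L generalizing lam p with
  | nil =>
    rw [descentChains_nil_ne_zero] at h
    rw [h, rowLen_bot]
  | cons a L ih =>
    obtain ⟨kap, h1, -, h2⟩ := descentChains_cons_ne_zero.1 h
    have h3 := ih h2
    have h4 := ((mem_downs.1 h1).2 L.length).2
    rw [List.length_cons]
    omega

theorem add_rowLen_le {kap lam : YoungDiagram} (h : kap ≤ lam) {i q : ℕ} (hi : i ≠ q) :
    lam.rowLen i + lam.rowLen q + kap.card ≤ kap.rowLen i + kap.rowLen q + lam.card := by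
  obtain ⟨N, hN, hiN, hqN⟩ : ∃ N, lam.rowLen N = 0 ∧ i < N ∧ q < N :=
    ⟨lam.card + i + q + 1, rowLen_eq_zero_of_le lam.rowLen_card (by omega), by omega, by omega⟩
  have hk : kap.rowLen N = 0 := Nat.le_zero.1 (hN ▸ le_iff_rowLen.1 h N)
  rw [card_eq_sum_rowLen _ hN, card_eq_sum_rowLen _ hk]
  have h1 : ∀ f : ℕ → ℕ, ∑ k ∈ Finset.range N, f k =
      f i + f q + ∑ k ∈ ((Finset.range N).erase i).erase q, f k := by
    intro f
    rw [add_assoc, Finset.add_sum_erase _ _ (by simp [hqN, hi.symm]),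
      Finset.add_sum_erase _ _ (by simp [hiN])]
  rw [h1 lam.rowLen, h1 kap.rowLen]
  have h2 := Finset.sum_le_sum (s := ((Finset.range N).erase i).erase q)
    fun k _ => le_iff_rowLen.1 h k
  omega

theorem rowLen_add_card_le {kap lam : YoungDiagram} (h : kap ≤ lam) (q : ℕ) :
    lam.rowLen q + kap.card ≤ kap.rowLen q + lam.card := by
  have h1 := add_rowLen_le h (i := q + 1) (q := q) (by omega)
  have h2 := le_iff_rowLen.1 h (q + 1)
  omega

theorem stripBot_le {kap lam : YoungDiagram} (h : kap ≤ lam) (hc : kap.card < lam.card) {q : ℕ}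
    (hq : lam.rowLen (q + 1) = 0) : stripBot kap lam ≤ q := by
  by_contra! hlt
  have h1 := (stripBot_spec h hc).1
  rw [rowLen_eq_zero_of_le hq hlt] at h1
  omega

/-- When q is the last possible row, every strip of the chain must have a box strictly above row q,
since the strip that follows starts in row q or higher. So strip i adds at most a_i - 1 boxes to row
q, and strips 0, …, q - 1 add none. -/
theorem rowLen_add_le_of_descentChains_ne_zero {a : ℕ → ℕ} (ha : ∀ i, 0 < a i) {q : ℕ} (t : ℕ) :
    ∀ {lam : YoungDiagram} {p : ℕ}, descentChains (stripSizes a t) lam p ≠ 0 → p ≤ q →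
      lam.rowLen (q + 1) = 0 → lam.rowLen q + (t - q) ≤ ∑ i ∈ Finset.Ico q t, a i := by
  induction t with
  | zero =>
    intro lam p h _ _
    rw [stripSizes, descentChains_nil_ne_zero] at h
    simp [h]
  | succ t ih =>
    intro lam p h hp hq
    have h0 := rowLen_eq_zero_of_descentChains_ne_zero h
    rw [length_stripSizes] at h0
    -- With at most q strips, row q is still empty.
    rcases le_or_gt (t + 1) q with hle | hlt
    · rw [rowLen_eq_zero_of_le h0 hle]
      omega
    rw [stripSizes] at h
    obtain ⟨kap, h1, ⟨i, hi, h2⟩, h3⟩ := descentChains_cons_ne_zero.1 h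
    rw [mem_downs] at h1
    have h4 := h1.2.le
    have h5 := ha t
    have h6 := le_iff_rowLen.1 h4 (q + 1)
    have h7 := ih h3 (stripBot_le h4 (by omega) hq) (by omega)
    have h8 := add_rowLen_le h4 (i := i) (q := q) (by omega)
    rw [Finset.sum_Ico_succ_top (by omega)]
    omega

/-- The last strip precedes no descent and may lie entirely in row q, so only the t - q strips q, …,
t - 1 each lose a box. -/
theorem rowLen_add_le_of_ribbonCoeff_ne_zero {a : ℕ → ℕ} (ha : ∀ i, 0 < a i) {q t : ℕ}
    (hqt : q ≤ t) {nu : YoungDiagram} (h : ribbonCoeff (stripSizes a (t + 1)) nu ≠ 0)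
    (hq : nu.rowLen (q + 1) = 0) :
    nu.rowLen q + (t - q) ≤ ∑ i ∈ Finset.Ico q (t + 1), a i := by
  rw [stripSizes] at h
  obtain ⟨lam, h1, h2⟩ := ribbonCoeff_cons_ne_zero.1 h
  rw [mem_downs] at h1
  have h4 := h1.2.le
  have h5 := ha t
  have h6 := le_iff_rowLen.1 h4 (q + 1)
  have h7 := rowLen_add_le_of_descentChains_ne_zero ha t h2 (stripBot_le h4 (by omega) hq)
    (by omega)
  have h8 := rowLen_add_card_le h4 q
  rw [Finset.sum_Ico_succ_top (by omega)]
  omega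

/-! ### Construction of a shape with a longer last row -/

/-- A diagram obtained by adding a horizontal strip, given by its row lengths `g`. -/
theorem exists_add_strip (kap : YoungDiagram) (g : ℕ → ℕ) (q b : ℕ)
    (h : ∀ i, kap.rowLen i ≤ g i ∧ g (i + 1) ≤ kap.rowLen i) (hq : kap.rowLen q < g q)
    (hq' : ∀ i, q < i → g i = kap.rowLen i)
    (hs : ∑ i ∈ Finset.range (q + 1), g i = ∑ i ∈ Finset.range (q + 1), kap.rowLen i + b) :
    ∃ lam : YoungDiagram, (∀ i, lam.rowLen i = g i) ∧ kap ∈ downs lam b ∧ stripBot kap lam = q := by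
  have hanti : Antitone g := antitone_nat_of_succ_le fun i => (h i).2.trans (h i).1
  obtain ⟨N, hN, hqN⟩ : ∃ N, kap.rowLen N = 0 ∧ q < N :=
    ⟨kap.card + q + 1, rowLen_eq_zero_of_le kap.rowLen_card (by omega), by omega⟩
  have hgN : g N = 0 := by rw [hq' N hqN, hN]
  refine ⟨ofFun g hanti ⟨N, hgN⟩, by simp, ?_, stripBot_eq (by simpa using hq) fun i hi => ?_⟩
  · rw [mem_downs]
    refine ⟨?_, by simpa [HStrip] using h⟩
    rw [card_eq_sum_rowLen (N := N) _ (by simpa using hgN), card_eq_sum_rowLen _ hN]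
    simp only [rowLen_ofFun]
    have h1 := Finset.sum_range_add_sum_Ico g (show q + 1 ≤ N from hqN)
    have h2 := Finset.sum_range_add_sum_Ico kap.rowLen (show q + 1 ≤ N from hqN)
    have h3 : ∑ i ∈ Finset.Ico (q + 1) N, g i = ∑ i ∈ Finset.Ico (q + 1) N, kap.rowLen i :=
      Finset.sum_congr rfl fun i hi => hq' i (Finset.mem_Ico.1 hi).1
    omega
  · rw [rowLen_ofFun, hq' i hi]

/-- There is a chain of `t` horizontal strips of sizes `b` with descents, which ends in the diagram
with row lengths `f` and whose last strip has a box above row `p`. -/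
def Reachable (b : ℕ → ℕ) (t : ℕ) (f : ℕ → ℕ) (p : ℕ) : Prop :=
  ∃ lam : YoungDiagram, (∀ i, lam.rowLen i = f i) ∧ descentChains (stripSizes b t) lam p ≠ 0

theorem Reachable.antitone {b : ℕ → ℕ} {t : ℕ} {f : ℕ → ℕ} {p : ℕ} (h : Reachable b t f p) :
    Antitone f := by
  obtain ⟨lam, h1, -⟩ := h
  intro i j hij
  rw [← h1, ← h1]
  exact lam.rowLen_anti i j hij

theorem Reachable.step {b : ℕ → ℕ} {t : ℕ} {f g : ℕ → ℕ} {p q : ℕ} (hf : Reachable b t f q)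
    (h : ∀ i, f i ≤ g i ∧ g (i + 1) ≤ f i) (hq : f q < g q) (hq' : ∀ i, q < i → g i = f i)
    (hs : ∑ i ∈ Finset.range (q + 1), g i = ∑ i ∈ Finset.range (q + 1), f i + b t)
    (hp : ∃ i < p, f i < g i) : Reachable b (t + 1) g p := by
  obtain ⟨kap, h1, h2⟩ := hf
  obtain rfl : kap.rowLen = f := funext h1
  obtain ⟨lam, g1, g2, g3⟩ := exists_add_strip kap g q (b t) h hq hq' hs
  obtain rfl : lam.rowLen = g := funext g1
  refine ⟨lam, fun _ => rfl, ?_⟩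
  rw [stripSizes, descentChains_cons_ne_zero]
  exact ⟨kap, g2, hp, by rwa [g3]⟩

/-- Each strip is placed in a row of its own. -/
theorem reachable_rows {b : ℕ → ℕ} (t : ℕ) (hb : ∀ i < t, 0 < b i)
    (hb' : ∀ i, i + 1 < t → b (i + 1) ≤ b i) :
    Reachable b t (fun i => if i < t then b i else 0) t := by
  induction t with
  | zero =>
    refine ⟨⊥, by simp, ?_⟩
    rw [stripSizes, descentChains_nil_ne_zero]
  | succ t ih =>
    have h1 := ih (fun i hi => hb i (by omega)) fun i hi => hb' i (by omega)
    refine h1.step (fun i => ?_) ?_ (fun i hi => ?_) ?_ ⟨t, by omega, ?_⟩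
    · have := hb' i
      split_ifs <;> omega
    · simpa using hb t (by omega)
    · rw [if_neg (by omega), if_neg (by omega)]
    · rw [Finset.sum_range_succ, Finset.sum_range_succ]
      rw [Finset.sum_congr rfl (g := fun i => if i < t then b i else 0)]
      · simp
      · intro i hi
        rw [Finset.mem_range] at hi
        simp [hi, hi.trans (Nat.lt_add_one t)]
    · simpa using hb t (by omega)

/-- The source of the saved box. Strips 0, …, J each fill their own row, leaving row J with length
a_{J+1}. Strip J + 1 has size a_J: it puts a_{J+1} boxes in row J + 1 and the remaining a_J -
a_{J+1} > 0 in row J. The boxes in row J already secure a descent to a next strip starting in row J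
+ 1. -/
theorem reachable_swap {a b : ℕ → ℕ} {J : ℕ} (ha : Antitone a) (hpos : ∀ i, 0 < a i)
    (hlt : a (J + 1) < a J) (hb : ∀ i, i ≠ J → i ≠ J + 1 → b i = a i) (hbJ : b J = a (J + 1))
    (hbJ' : b (J + 1) = a J) :
    Reachable b (J + 2) (fun i => if i < J + 2 then a i else 0) (J + 1) := by
  have h1 : Reachable b (J + 1) (fun i => if i < J + 1 then b i else 0) (J + 1) := by
    refine reachable_rows (J + 1) (fun i hi => ?_) fun i hi => ?_
    · rcases eq_or_ne i J with rfl | h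
      · rw [hbJ]
        exact hpos _
      · rw [hb i h (by omega)]
        exact hpos _
    · rw [hb i (by omega) (by omega)]
      rcases eq_or_ne (i + 1) J with h | h
      · rw [h, hbJ]
        exact ha (by omega)
      · rw [hb (i + 1) h (by omega)]
        exact ha (by omega)
  have hf : ∀ i, i < J → b i = a i := fun i hi => hb i (by omega) (by omega)
  refine h1.step (fun i => ?_) ?_ (fun i hi => ?_) ?_ ⟨J, by omega, ?_⟩
  · rcases lt_trichotomy i J with h | h | h
    · rw [if_pos (by omega), if_pos (by omega), if_pos (by omega), hf i h]
      exact ⟨le_rfl, ha (by omega)⟩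
    · subst h
      rw [if_pos (by omega), if_pos (by omega), if_pos (by omega), hbJ]
      exact ⟨hlt.le, le_rfl⟩
    · rw [if_neg (show ¬ i < J + 1 by omega), if_neg (show ¬ i + 1 < J + 2 by omega)]
      exact ⟨Nat.zero_le _, le_rfl⟩
  · simpa using hpos (J + 1)
  · rw [if_neg (by omega), if_neg (by omega)]
  · rw [Finset.sum_range_succ, Finset.sum_range_succ, Finset.sum_range_succ,
      Finset.sum_range_succ]
    rw [Finset.sum_congr rfl (g := a), Finset.sum_congr rfl (g := a)
      (f := fun i => if i < J + 1 then b i else 0)]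
    · simp only [lt_add_iff_pos_right, Nat.lt_add_one, if_true, lt_self_iff_false, if_false, hbJ,
        hbJ', show J < J + 2 by omega, show J + 1 < J + 2 by omega]
      omega
    · intro i hi
      rw [Finset.mem_range] at hi
      rw [if_pos (by omega), hf i hi]
    · intro i hi
      rw [Finset.mem_range] at hi
      rw [if_pos (by omega)]
  · simpa [hbJ] using hlt

/-- The invariant of the greedy construction: row `J + 1` receives all but one box of each strip,
and the rows above it can still be filled up to length `M`. -/
theorem reachable_greedy {a b : ℕ → ℕ} {J n M : ℕ} (ha2 : ∀ i, 2 ≤ a i)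
    (hb : ∀ i, J + 1 < i → b i = a i)
    (hbase : Reachable b (J + 2) (fun i => if i < J + 2 then a i else 0) (J + 1))
    (hM : M + (n - (J + 2)) = ∑ i ∈ Finset.Ico (J + 1) (n + 1), a i)
    (hdef : ∑ i ∈ Finset.range (J + 1), (M - a i) ≤ n - (J + 2)) (s : ℕ)
    (hs : J + 2 + s ≤ n) :
    ∃ f : ℕ → ℕ, Reachable b (J + 2 + s) f (J + 1) ∧ (∀ i, J + 1 < i → f i = 0) ∧
      f (J + 1) + ∑ i ∈ Finset.Ico (J + 2 + s) (n + 1), a i = M + (n - (J + 2 + s)) ∧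
      ∑ i ∈ Finset.range (J + 1), (M - f i) ≤ n - (J + 2 + s) := by
  induction s with
  | zero =>
    refine ⟨_, hbase, fun i hi => if_neg (by omega), ?_, ?_⟩
    · rw [add_zero, hM, Finset.sum_eq_sum_Ico_succ_bot (a := J + 1) (by omega)]
      simp
    · refine le_trans (le_of_eq (Finset.sum_congr rfl fun i hi => ?_)) hdef
      rw [Finset.mem_range] at hi
      rw [if_pos (by omega)]
  | succ s ih =>
    obtain ⟨f, h1, h2, h3, h4⟩ := ih (by omega)
    set t := J + 2 + s with ht
    -- The remaining strips have size at least 2, so row J + 1 is still so short that its next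
    -- extension fits under row J, whose deficit is at most n - t.
    have hat := ha2 t
    have hanti := h1.antitone
    have hrest : 2 * (n - t) ≤ ∑ i ∈ Finset.Ico (t + 1) (n + 1), a i := by
      refine le_trans ?_ (Finset.card_nsmul_le_sum (Finset.Ico (t + 1) (n + 1)) a 2
        fun i _ => ha2 i)
      rw [Nat.card_Ico, smul_eq_mul]
      omega
    rw [Finset.sum_eq_sum_Ico_succ_bot (by omega)] at h3
    have hJ : M - f J ≤ n - t := (Finset.single_le_sum (f := fun i => M - f i)
      (fun _ _ => Nat.zero_le _) (Finset.mem_range.2 (Nat.lt_add_one J))).trans h4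
    -- The spare box goes to the topmost row shorter than M: the row above it has length at least M,
    -- so the strip stays horizontal. If no row is short, row 0 takes it.
    obtain ⟨r, hrJ, hr, hr'⟩ : ∃ r, r ≤ J ∧ (∀ i, i + 1 = r → f r < f i) ∧
        ((∀ i, i ≤ J → M ≤ f i) ∨ f r < M) := by
      by_cases h : ∃ i, i ≤ J ∧ f i < M
      · classical
        refine ⟨Nat.find h, (Nat.find_spec h).1, fun i hi => ?_, Or.inr (Nat.find_spec h).2⟩
        have g1 := Nat.find_min h (m := i) (by omega)
        have g2 := Nat.find_spec h
        by_contra! hle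
        exact g1 ⟨by omega, by omega⟩
      · push Not at h
        exact ⟨0, Nat.zero_le _, fun i hi => by omega, Or.inl h⟩
    refine ⟨fun i => f i + (if i = J + 1 then a t - 1 else 0) + (if i = r then 1 else 0),
      h1.step (fun i => ⟨by omega, ?_⟩) ?_ (fun i hi => ?_) ?_ ⟨r, by omega, ?_⟩,
      fun i hi => ?_, ?_, ?_⟩
    · have g1 := hanti (Nat.le_succ i)
      simp only [Nat.succ_eq_add_one] at g1
      by_cases hi : i = J
      · subst hi
        rw [if_pos rfl, if_neg (by omega)]
        omega
      · rw [if_neg (by omega)]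
        split_ifs with hir
        · have := hr i hir
          rw [← hir] at this
          omega
        · omega
    · simp only [if_true]
      omega
    · rw [if_neg (by omega), if_neg (by omega)]
      rfl
    · rw [Finset.sum_add_distrib, Finset.sum_add_distrib, Finset.sum_ite_eq', Finset.sum_ite_eq',
        if_pos (by simp), if_pos (by simp; omega), hb t (by omega)]
      omega
    · simp only [if_true]
      omega
    · simp only
      rw [h2 i hi, if_neg (by omega), if_neg (by omega)]
    · simp only [if_true]
      rw [if_neg (by omega), show J + 2 + (s + 1) = t + 1 by omega]
      omega
    · beta_reduce
      rcases hr' with hall | hlt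
      · refine (Finset.sum_eq_zero fun i hi => ?_).trans_le (Nat.zero_le _)
        have := hall i (by rw [Finset.mem_range] at hi; omega)
        omega
      · have g1 : ∑ i ∈ Finset.range (J + 1),
            (M - (f i + (if i = J + 1 then a t - 1 else 0) + (if i = r then 1 else 0))) +
            ∑ i ∈ Finset.range (J + 1), (if i = r then 1 else 0) =
            ∑ i ∈ Finset.range (J + 1), (M - f i) := by
          rw [← Finset.sum_add_distrib]
          refine Finset.sum_congr rfl fun i hi => ?_
          rw [Finset.mem_range] at hi
          rw [if_neg (by omega)]
          split_ifs with h
          · subst h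
            omega
          · omega
        rw [Finset.sum_ite_eq', if_pos (by simp; omega)] at g1
        omega

/-- After the greedy phase the rows above row J + 1 have length at least M. The last strip needs no
box above, so it goes entirely into row J + 1 and brings it to exactly M. -/
theorem exists_ribbonCoeff_swap_ne_zero {a b : ℕ → ℕ} {J n M : ℕ} (hJ : J + 2 ≤ n)
    (hbase : Reachable b (J + 2) (fun i => if i < J + 2 then a i else 0) (J + 1))
    (ha2 : ∀ i, 2 ≤ a i) (hb : ∀ i, J + 1 < i → b i = a i)
    (hM : M + (n - (J + 2)) = ∑ i ∈ Finset.Ico (J + 1) (n + 1), a i)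
    (hdef : ∑ i ∈ Finset.range (J + 1), (M - a i) ≤ n - (J + 2)) :
    ∃ nu : YoungDiagram, nu.rowLen (J + 1) = M ∧ nu.rowLen (J + 2) = 0 ∧
      ribbonCoeff (stripSizes b (n + 1)) nu ≠ 0 := by
  obtain ⟨f, h1, h2, h3, h4⟩ := reachable_greedy ha2 hb hbase hM hdef (n - (J + 2)) (by omega)
  rw [show J + 2 + (n - (J + 2)) = n by omega] at h1 h3 h4
  rw [Nat.Ico_succ_singleton, Finset.sum_singleton, Nat.sub_self, add_zero] at h3
  rw [Nat.sub_self, Nat.le_zero, Finset.sum_eq_zero_iff] at h4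
  have h5 := h4 J (by simp)
  have han := ha2 n
  have hanti := h1.antitone
  obtain ⟨lam, g1, g2⟩ := h1
  obtain rfl : lam.rowLen = f := funext g1
  have hstrip : ∀ i, lam.rowLen i ≤ lam.rowLen i + (if i = J + 1 then a n else 0) ∧
      lam.rowLen (i + 1) + (if i + 1 = J + 1 then a n else 0) ≤ lam.rowLen i := by
    intro i
    refine ⟨by omega, ?_⟩
    have := hanti (Nat.le_succ i)
    simp only [Nat.succ_eq_add_one] at this
    split_ifs with h
    · obtain rfl : i = J := by omega
      omega
    · omega
  obtain ⟨nu, k1, k2, k3⟩ := exists_add_strip lam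
    (fun i => lam.rowLen i + if i = J + 1 then a n else 0) (J + 1) (b n) hstrip
    (by simp only [if_true]; omega) (fun i hi => by rw [if_neg (by omega), add_zero])
    (by rw [Finset.sum_add_distrib, Finset.sum_ite_eq', if_pos (by simp), hb n (by omega)])
  refine ⟨nu, ?_, ?_, ?_⟩
  · rw [k1, if_pos rfl, h3]
  · rw [k1, if_neg (by omega), h2 _ (by omega)]
  · rw [stripSizes, ribbonCoeff_cons_ne_zero]
    exact ⟨lam, k2, by rwa [k3]⟩

end YoungDiagram

/-! ### Comparison of the two supports -/

open YoungDiagram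

namespace Ribbon

variable {m : ℕ}

/-- The row lengths of a ribbon as a sequence that continues with the value `2`. -/
def extLen (α : Ribbon m) (i : ℕ) : ℕ := if h : i < m then α.rowLen ⟨i, h⟩ else 2

theorem extLen_coe (α : Ribbon m) (i : Fin m) : α.extLen i = α.rowLen i := dif_pos i.2

theorem two_le_extLen (α : Ribbon m) (i : ℕ) : 2 ≤ α.extLen i := by
  unfold extLen
  split_ifs
  · exact α.two_le _
  · exact le_rfl

theorem extLen_antitone {α : Ribbon m} (hα : Antitone α.rowLen) : Antitone α.extLen := by
  intro i j hij
  unfold extLen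
  split_ifs with h1 h2 h2
  · exact hα hij
  · omega
  · exact α.two_le _
  · exact le_rfl

theorem rowLensUp_eq (α : Ribbon m) {a : ℕ → ℕ} (h : ∀ i : Fin m, α.rowLen i = a i) :
    α.rowLensUp = stripSizes a m := reverse_ofFn_eq_stripSizes _ _ h

theorem sum_Ioi_rowLen (α : Ribbon m) (j : Fin m) :
    ∑ i ∈ Finset.Ioi j, α.rowLen i = ∑ i ∈ Finset.Ico (j.val + 1) m, α.extLen i := by
  have h : (Finset.Ioi j).map Fin.valEmbedding = Finset.Ico (j.val + 1) m := by
    ext i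
    simp only [Finset.mem_map, Finset.mem_Ioi, Fin.valEmbedding_apply, Finset.mem_Ico]
    constructor
    · rintro ⟨k, hk, rfl⟩
      exact ⟨hk, k.2⟩
    · rintro ⟨h1, h2⟩
      exact ⟨⟨i, h2⟩, h1, rfl⟩
  rw [← h, Finset.sum_map]
  exact Finset.sum_congr rfl fun i _ => (α.extLen_coe i).symm

/-- Truncated subtraction absorbs the condition that the row is shorter than k. -/
theorem sum_deficit_le (α : Ribbon m) (j : Fin m) {k : ℕ} (hk : k ∈ α.necSet j) :
    ((∑ i ∈ Finset.range (j.val + 1), (k - α.extLen i) : ℕ) : ℤ) ≤ slack j := by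
  have h : (Finset.Iic j).map Fin.valEmbedding = Finset.range (j.val + 1) := by
    ext i
    simp only [Finset.mem_map, Finset.mem_Iic, Fin.valEmbedding_apply, Finset.mem_range]
    constructor
    · rintro ⟨l, hl, rfl⟩
      exact Nat.lt_succ_of_le hl
    · intro h1
      exact ⟨⟨i, by omega⟩, Nat.lt_succ_iff.1 h1, rfl⟩
  refine le_trans (le_of_eq ?_) hk
  rw [← h, Finset.sum_map, Nat.cast_sum, ← Finset.filter_filter, Finset.sum_filter]
  refine Finset.sum_congr (by ext; simp) fun i _ => ?_
  rw [Fin.valEmbedding_apply, α.extLen_coe]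
  split_ifs with h1
  · exact Nat.cast_sub h1.le
  · rw [Nat.sub_eq_zero_of_le (not_lt.1 h1), Nat.cast_zero]

theorem necMax_lt_of_support_eq {α : Ribbon m} (hα : Antitone α.rowLen) {j j' : Fin m}
    (hj : j.val + 2 < m) (hj' : j'.val = j.val + 1)
    (hs : α.support = (α.perm (Equiv.swap j j')).support) :
    (α.necMax j : ℤ) < (∑ i ∈ Finset.Ioi j, (α.rowLen i : ℤ)) - slack j := by
  by_contra! hle
  obtain ⟨n, rfl⟩ : ∃ n, m = n + 1 := ⟨m - 1, by omega⟩
  set a := α.extLen with ha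
  set J := j.val with hJ
  have hnec := α.sum_deficit_le j (α.isGreatest_necMax j hj).1
  rw [← Nat.cast_sum, α.sum_Ioi_rowLen, ← ha, ← hJ] at hle
  have hslack : slack j = ((n - (J + 2) : ℕ) : ℤ) := by
    rw [slack, Nat.cast_sub (by omega)]
    push_cast
    omega
  rw [hslack, ← ha] at hnec
  rw [hslack] at hle
  have ha2 : ∀ i, 2 ≤ a i := α.two_le_extLen
  have hanti : Antitone a := extLen_antitone hα
  have hrest : 2 * (n - (J + 1)) ≤ ∑ i ∈ Finset.Ico (J + 2) (n + 1), a i := by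
    refine le_trans ?_ (Finset.card_nsmul_le_sum (Finset.Ico (J + 2) (n + 1)) a 2 fun i _ => ha2 i)
    rw [Nat.card_Ico, smul_eq_mul]
    omega
  have hsplit : ∑ i ∈ Finset.Ico (J + 1) (n + 1), a i =
      a (J + 1) + ∑ i ∈ Finset.Ico (J + 2) (n + 1), a i :=
    Finset.sum_eq_sum_Ico_succ_bot (by omega) a
  -- M is the right side of the claimed inequality, one more than the bound available for row J + 1
  -- in the support of α.
  obtain ⟨M, hM⟩ : ∃ M, M + (n - (J + 2)) = ∑ i ∈ Finset.Ico (J + 1) (n + 1), a i :=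
    ⟨∑ i ∈ Finset.Ico (J + 1) (n + 1), a i - (n - (J + 2)), by omega⟩
  have hdef : ∑ i ∈ Finset.range (J + 1), (M - a i) ≤ n - (J + 2) := by
    refine le_trans (Finset.sum_le_sum fun i _ => ?_) (Nat.cast_le.1 hnec)
    have : M ≤ α.necMax j := by omega
    omega
  -- Strictness is forced: M is at least a_{J+1} + (n - J) because the later rows have length at
  -- least 2, while the deficit M - a_J is at most n - J - 2.
  have hlt : a (J + 1) < a J := by
    have h1 : M - a J ≤ n - (J + 2) := (Finset.single_le_sum (f := fun i => M - a i)
      (fun _ _ => Nat.zero_le _) (Finset.mem_range.2 (Nat.lt_add_one J))).trans hdef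
    omega
  let b : ℕ → ℕ := fun i => if i = J then a (J + 1) else if i = J + 1 then a J else a i
  have hb : ∀ i, i ≠ J → i ≠ J + 1 → b i = a i := fun i h1 h2 => by simp [b, h1, h2]
  have hbase := reachable_swap (b := b) hanti (fun i => by have := ha2 i; omega) hlt hb
    (by simp [b]) (by simp [b])
  obtain ⟨nu, h1, h2, h3⟩ := exists_ribbonCoeff_swap_ne_zero (by omega) hbase ha2
    (fun i hi => hb i (by omega) (by omega)) hM hdef
  have hβ : (α.perm (Equiv.swap j j')).rowLensUp = stripSizes b (n + 1) := by
    refine rowLensUp_eq _ fun i => ?_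
    change α.rowLen ((Equiv.swap j j')⁻¹ i) = b i
    rw [Equiv.swap_inv]
    by_cases g1 : i = j
    · subst g1
      rw [Equiv.swap_apply_left, ← α.extLen_coe, hj']
      simp [b, ha, hJ]
    · by_cases g2 : i = j'
      · rw [g2, Equiv.swap_apply_right, ← α.extLen_coe]
        simp [b, ha, hj', hJ]
      · rw [Equiv.swap_apply_of_ne_of_ne g1 g2, ← α.extLen_coe,
          hb i (fun h => g1 (Fin.ext h)) fun h => g2 (Fin.ext (h.trans hj'.symm))]
  have hmem : nu ∈ (α.perm (Equiv.swap j j')).support := by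
    rw [mem_support_iff (by omega), hβ]
    exact h3
  rw [← hs, mem_support_iff (by omega),
    α.rowLensUp_eq (a := a) fun i => (α.extLen_coe i).symm] at hmem
  have h4 := rowLen_add_le_of_ribbonCoeff_ne_zero (fun i => by have := ha2 i; omega)
    (show J + 1 ≤ n by omega) hmem h2
  rw [h1] at h4
  omega

end Ribbon

theorem mainTheorem3 (m : ℕ) (hm : 3 ≤ m) (α : Ribbon m) (hα : Antitone α.rowLen) :
    (∀ (j : Fin m) (hj : j.val + 2 < m),
      α.support = (α.perm (Equiv.swap j ⟨j.val + 1, by omega⟩)).support →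
        (α.necMax j : ℤ) < (∑ i ∈ Finset.Ioi j, (α.rowLen i : ℤ)) - Ribbon.slack j) ∧
    (α.HasFullEquivalenceClass →
      ∀ j : Fin m, j.val + 2 < m →
        (α.necMax j : ℤ) < (∑ i ∈ Finset.Ioi j, (α.rowLen i : ℤ)) - Ribbon.slack j) :=
  ⟨fun j hj hs => Ribbon.necMax_lt_of_support_eq hα hj rfl hs,
    fun hfull j hj => Ribbon.necMax_lt_of_support_eq hα hj (j' := ⟨j.val + 1, by omega⟩) rfl
      (hfull _)⟩
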